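/- **Setting.** Let $\Omega\subset\mathbb R^2$ be a bounded open set, $\mathcal H=L^2(\Omega)$ (real), $a>0$, $\mathbf v\in\mathbb R^2$, and let $\mathcal S(\cdot)$ be the strongly continuous semigroup on $\mathcal H$ generated by $\mathcal A\psi=a\nabla^2\psi-\mathbf v\cdot\nabla\psi$ with domain $\{\psi\in H_0^1(\Omega):\nabla^2\psi\in L^2(\Omega)\}$. Let $t_f>0$, let $\alpha\in\mathbb R^{n\times n}$, $\beta\in\mathbb R^{n\times m}$, $\zeta_0\in\mathbb R^n$, and let $M\in\mathbb R^{2m_s\times n}$ be the matrix for which $M\zeta$ lists the planar locations $x_1(\zeta),\dots,x_{m_s}(\zeta)\in\mathbb R^2$ of the $m_s$ sensors when the joint sensor state is $\zeta$. Let $R=\mathrm{diag}(\sigma_1^2,\dots,\sigma_{m_s}^2)$ with $\sigma_i>0$. Sensor $i$ has output kernels $\mathcal C_i(x,t)\in\mathcal H$ ($x\in\mathbb R^2$, $t\in[0,t_f]$). For a continuous $\zeta:[0,t_f]\to\mathbb R^n$ put $$\bar{\mathcal C}\bar{\mathcal C}^\star(t)\,\phi=\sum_{i=1}^{m_s}\sigma_i^{-2}\,\mathcal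 C_i(x_i(\zeta(t)),t)\,\langle \mathcal C_i(x_i(\zeta(t)),t),\phi\rangle .$$ Let $\Pi_0$ and $Q(t)$, $t\in[0,t_f]$, be bounded operators on $\mathcal H$. "Nonnegative" means self-adjoint and positive semidefinite. For $1\le q<\infty$, $\mathcal J_q(\mathcal H)$ is the Schatten class with norm $\|B\|_{\mathcal J_q}=(\mathrm{Tr}\,(B^\star B)^{q/2})^{1/q}$. **Approximation.** For each $N$ let $\mathcal H_N\subset\mathcal H$ be a finite-dimensional subspace with orthogonal projection $P_N$; put $\Pi_{0,N}=P_N\Pi_0P_N$ and $Q_N(t)=P_NQ(t)P_N$. Let $S_N(\cdot)$ be a uniformly continuous semigroup on $\mathcal H_N$ (extended to $\mathcal H$ by $P_N$) which is either given by $S_N(t)=P_N\mathcal S(t)P_N$ for $t\ge 0$ (when this is a semigroup on $\mathcal H_N$), or, in case $\mathcal H_N\subset\mathrm{Dom}(\mathcal A)$, is generated by the Galerkin approximation $A_N=P_N\mathcal A|_{\mathcal H_N}$. Let $C_{i,N}(x,t)\in\mathcal H_N$ be approximate output kernels and define $\bar C_N\bar C_N^\star(t)$ like $\bar{\mathcal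 C}\bar{\mathcal C}^\star(t)$ with $C_{i,N}$ in place of $\mathcal C_i$. **Assumptions**, for some $1\le q<\infty$: * (A5) $\Pi_0$ and all $\Pi_{0,N}$ are nonnegative elements of $\mathcal J_q(\mathcal H)$, and $\|\Pi_0-\Pi_{0,N}\|_{\mathcal J_q}\to0$ as $N\to\infty$. * (A6) $Q$ and all $Q_N$ are elements of $L^1([0,t_f];\mathcal J_q(\mathcal H))$ with nonnegative values at every $t\in[0,t_f]$, and $\int_0^t\|Q(\tau)-Q_N(\tau)\|_{\mathcal J_q}\,d\tau\to0$ as $N\to\infty$ for all $t\in[0,t_f]$. * (A7) For every continuous $\zeta:[0,t_f]\to\mathbb R^n$: $\bar{\mathcal C}\bar{\mathcal C}^\star$ and all $\bar C_N\bar C_N^\star$ are elements of $L^\infty([0,t_f];\mathcal L(\mathcal H))$ with nonnegative values, and $\operatorname{ess\,sup}_{t\in[0,t_f]}\|\bar{\mathcal C}\bar{\mathcal C}^\star(t)-\bar C_N\bar C_N^\star(t)\|_{\rm op}\to0$ as $N\to\infty$. * (A8) For each $N$ there is a continuous $l_N:\mathbb R^+\to\mathbb R^+$ with $l_N(0)=0$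 and $\|C_{i,N}(x_1,t)-C_{i,N}(x_2,t)\|_{L^2(\Omega)}\le l_N(|x_1-x_2|_2)$ for all $t\in[0,t_f]$, $x_1,x_2\in\mathbb R^2$ and all $i$. * (A9) $P\subset\mathbb R^m$ is nonempty, closed and convex. * (A10) $h:\mathbb R^n\times[0,t_f]\to\mathbb R^+$, $g:\mathbb R^m\times[0,t_f]\to\mathbb R^+$ and $h_f:\mathbb R^n\to\mathbb R^+$ are continuous, and $g(\cdot,t)$ is convex for every $t\in[0,t_f]$. * (A11) There is $d_1>0$ with $g(p,t)\ge d_1|p|_2^2$ for all $(p,t)\in P\times[0,t_f]$. **Problem (AP).** Minimize over $p\in\mathcal P:=L^2([0,t_f];P)$ the cost $$\int_0^{t_f}\big(\mathrm{Tr}\,\Pi_N(t)+h(\zeta(t),t)+g(p(t),t)\big)\,dt+h_f(\zeta(t_f))\in[0,\infty],$$ where $\zeta$ is the continuous solution of $\zeta(t)=\zeta_0+\int_0^t(\alpha\zeta(\tau)+\beta p(\tau))\,d\tau$ on $[0,t_f]$, i.e. of $\dot\zeta=\alpha\zeta+\beta p$, $\zeta(0)=\zeta_0$, and $\Pi_N:[0,t_f]\to\mathcal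 L(\mathcal H)$ is the continuous solution of $$\Pi_N(t)=S_N(t)\Pi_{0,N}S_N^\star(t)+\int_0^tS_N(t-\tau)\big(Q_N(\tau)-\Pi_N(\tau)\,\bar C_N\bar C_N^\star(\tau)\,\Pi_N(\tau)\big)S_N^\star(t-\tau)\,d\tau .$$ **Theorem.** Under (A5)–(A11), for every $N$, problem (AP) is well posed and has an optimal solution: every $p\in\mathcal P$ determines $\zeta$ and $\Pi_N$ on $[0,t_f]$ uniquely, with $\Pi_N(t)$ nonnegative, and there is $p_N^*\in\mathcal P$ whose cost is finite and not larger than the cost of any $p\in\mathcal P$. -/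

import Mathlib

open MeasureTheory Set Filter Topology
open scoped ENNReal NNReal ContDiff

noncomputable section

/-- The plane `ℝ²` with its Euclidean norm. -/
abbrev Plane : Type := EuclideanSpace ℝ (Fin 2)

/-- The state space `L²(Ω)`. -/
abbrev StateSpace (Ω : Set Plane) : Type := Lp ℝ 2 (volume.restrict Ω)

/-! ### The diffusion-advection operator and the semigroup it generates -/

/-- Smooth functions with compact support in `Ω`. -/
def IsTestFunction (Ω : Set Plane) (φ : Plane → ℝ) : Prop :=
  ContDiff ℝ ∞ φ ∧ HasCompactSupport φ ∧ tsupport φ ⊆ Ω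

/-- `ψ ∈ H₀¹(Ω)` and its weak partial derivatives are `G 0`, `G 1`: the pair `(ψ, ∇ψ)` is an
`L²` limit of `(φₖ, ∇φₖ)` with test functions `φₖ`. -/
def HasGradientH10 (Ω : Set Plane) (ψ : StateSpace Ω) (G : Fin 2 → StateSpace Ω) : Prop :=
  ∃ φ : ℕ → Plane → ℝ, (∀ k, IsTestFunction Ω (φ k)) ∧
    Tendsto (fun k => eLpNorm (fun x => φ k x - ψ x) 2 (volume.restrict Ω)) atTop (𝓝 0) ∧
    ∀ i : Fin 2, Tendsto
      (fun k => eLpNorm (fun x => fderiv ℝ (φ k) x (EuclideanSpace.single i 1) - G i x) 2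
        (volume.restrict Ω)) atTop (𝓝 0)

/-- `L ∈ L²(Ω)` is the distributional Laplacian of `ψ ∈ L²(Ω)`. -/
def HasWeakLaplacian (Ω : Set Plane) (ψ L : StateSpace Ω) : Prop :=
  ∀ φ : Plane → ℝ, IsTestFunction Ω φ →
    ∫ x in Ω, ψ x * Laplacian.laplacian φ x = ∫ x in Ω, L x * φ x

/-- The graph of `𝒜 ψ = a ∇²ψ - v · ∇ψ` with domain `{ψ ∈ H₀¹(Ω) : ∇²ψ ∈ L²(Ω)}`:
`ψ` lies in the domain and `𝒜 ψ = χ`. -/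
def DiffusionAdvection (Ω : Set Plane) (a : ℝ) (v : Plane) (ψ χ : StateSpace Ω) : Prop :=
  ∃ (G : Fin 2 → StateSpace Ω) (L : StateSpace Ω),
    HasGradientH10 Ω ψ G ∧ HasWeakLaplacian Ω ψ L ∧ χ = a • L - ∑ i, v i • G i

section HilbertSpace

/-- `χ` is the value at `ψ` of the infinitesimal generator of `T`, i.e. the limit of
`(T(t) ψ - ψ) / t` as `t ↓ 0`. -/
def HasGeneratorAt {H : Type*} [NormedAddCommGroup H] [InnerProductSpace ℝ H]
    (T : ℝ → H →L[ℝ] H) (ψ χ : H) : Prop :=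
  Tendsto (fun t : ℝ => t⁻¹ • (T t ψ - ψ)) (𝓝[>] 0) (𝓝 χ)

/-- `S` (restricted to `t ≥ 0`) is a strongly continuous semigroup whose generator has the
graph `A`. -/
structure IsSemigroupGeneratedBy {H : Type*} [NormedAddCommGroup H] [InnerProductSpace ℝ H]
    (A : H → H → Prop) (S : ℝ → H →L[ℝ] H) : Prop where
  zero : S 0 = ContinuousLinearMap.id ℝ H
  add : ∀ s t : ℝ, 0 ≤ s → 0 ≤ t → S (s + t) = S s ∘L S t
  continuousOn : ∀ x : H, ContinuousOn (fun t => S t x) (Ici 0)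
  generator : ∀ ψ χ : H, A ψ χ ↔ HasGeneratorAt S ψ χ

/-- `SN` is a uniformly continuous semigroup on the finite-dimensional subspace `U` (extended
to the whole space by means of the orthogonal projection `P` onto `U`) that approximates the
semigroup `S` with generator `A` in one of two ways: either `SN(t) = P S(t) P` for `t ≥ 0`, or
`U` is contained in the domain of `A` and `SN` is generated by the Galerkin approximation
`P A|_U` of `A`. -/
structure IsApproxSemigroup {H : Type*} [NormedAddCommGroup H] [InnerProductSpace ℝ H]
    (A : H → H → Prop) (S : ℝ → H →L[ℝ] H) (U : Submodule ℝ H) [FiniteDimensional ℝ U]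
    (SN : ℝ → H →L[ℝ] H) : Prop where
  zero : SN 0 = U.starProjection
  add : ∀ s t : ℝ, 0 ≤ s → 0 ≤ t → SN (s + t) = SN s ∘L SN t
  continuousOn : ContinuousOn SN (Ici 0)
  approx : (∀ t : ℝ, 0 ≤ t → SN t = U.starProjection ∘L S t ∘L U.starProjection) ∨
    (∀ ψ ∈ U, ∃ χ, A ψ χ ∧ HasGeneratorAt SN ψ (U.starProjection χ))

/-! ### Trace and Schatten classes -/

/-- The trace `∑ᵢ ⟪φᵢ, G φᵢ⟫ ∈ [0, ∞]` of a nonnegative operator `G`, computed in some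
orthonormal basis `(φᵢ)` (the value does not depend on it). -/
def opTrace {H : Type*} [NormedAddCommGroup H] [InnerProductSpace ℝ H] [CompleteSpace H]
    (G : H →L[ℝ] H) : ℝ≥0∞ :=
  let b := Classical.choose (Classical.choose_spec (exists_hilbertBasis ℝ H))
  ∑' i, ENNReal.ofReal (inner ℝ (b i) (G (b i)))

/-- The `𝒥_q`-norm `(Tr [B]^q)^(1/q)`, where `[B] = √(B⋆ B)`, with value `∞` outside `𝒥_q`.
If `(bᵢ)` is an orthonormal basis of eigenvectors of `B⋆ B`, say `B⋆ B bᵢ = sᵢ² bᵢ` with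
`sᵢ ≥ 0`, then `[B]^q bᵢ = sᵢ^q bᵢ` and `Tr [B]^q = ∑ᵢ sᵢ^q`, whichever such basis is taken.
An operator in `𝒥_q` is compact, so that such a basis exists for it; without such a basis the
infimum is over the empty set and equals `∞`. -/
def schattenNorm {H : Type*} [NormedAddCommGroup H] [InnerProductSpace ℝ H] [CompleteSpace H]
    (q : ℝ) (B : H →L[ℝ] H) : ℝ≥0∞ :=
  sInf {c | ∃ (w : Set H) (b : HilbertBasis w ℝ H) (s : w → ℝ≥0),
    (∀ i, (ContinuousLinearMap.adjoint B ∘L B) (b i) = ((s i : ℝ) ^ 2) • b i) ∧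
    c = (∑' i, (s i : ℝ≥0∞) ^ q) ^ (1 / q)}

/-- `F ∈ L¹([0,T]; 𝒥_q(H))` (Bochner): `F` is almost everywhere the limit in `𝒥_q` of simple
functions with values in `𝒥_q`, and `∫₀ᵀ ‖F(t)‖_{𝒥_q} dt < ∞`. -/
def MemL1Schatten {H : Type*} [NormedAddCommGroup H] [InnerProductSpace ℝ H] [CompleteSpace H]
    (q T : ℝ) (F : ℝ → H →L[ℝ] H) : Prop :=
  (∃ s : ℕ → SimpleFunc ℝ (H →L[ℝ] H),
    (∀ k t, schattenNorm q (s k t) < ⊤) ∧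
    ∀ᵐ t ∂(volume.restrict (Icc 0 T)),
      Tendsto (fun k => schattenNorm q (F t - s k t)) atTop (𝓝 0)) ∧
  ∫⁻ t in Icc 0 T, schattenNorm q (F t) < ⊤

/-- The compression `P B P` of `B` to the subspace `U`. -/
def compress {H : Type*} [NormedAddCommGroup H] [InnerProductSpace ℝ H]
    (U : Submodule ℝ H) [FiniteDimensional ℝ U] (B : H →L[ℝ] H) : H →L[ℝ] H :=
  U.starProjection ∘L B ∘L U.starProjection

/-! ### Sensors -/

/-- The location in the plane of the `i`-th sensor when the joint sensor state is `z`; the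
vector `M z` lists the locations of all sensors. -/
def sensorLocation {ms n : ℕ} (M : Matrix (Fin ms × Fin 2) (Fin n) ℝ)
    (z : EuclideanSpace ℝ (Fin n)) (i : Fin ms) : Plane :=
  WithLp.toLp 2 fun k => Matrix.toEuclideanLin M z (i, k)

/-- The composite output operator `C R⁻¹ C⋆ = ∑ᵢ σᵢ⁻² cᵢ ∘ cᵢ` at time `t`, where
`R = diag(σ₁², …)` and `cᵢ = C i x t` is the output kernel of sensor `i` at its location `x`
along the trajectory `ζ`. -/
def outputOp {H : Type*} [NormedAddCommGroup H] [InnerProductSpace ℝ H] {ms n : ℕ}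
    (σ : Fin ms → ℝ) (M : Matrix (Fin ms × Fin 2) (Fin n) ℝ) (C : Fin ms → Plane → ℝ → H)
    (ζ : ℝ → EuclideanSpace ℝ (Fin n)) (t : ℝ) : H →L[ℝ] H :=
  ∑ i, ((σ i) ^ 2)⁻¹ • InnerProductSpace.rankOne ℝ
    (C i (sensorLocation M (ζ t) i) t) (C i (sensorLocation M (ζ t) i) t)

/-- `ζ` solves `ζ' = α ζ + β p`, `ζ(0) = ζ₀` on `[0,T]` (for guidance in `L²`, hence in the
integrated sense). -/
def IsSensorTrajectory {n m : ℕ} (T : ℝ) (α : Matrix (Fin n) (Fin n) ℝ)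
    (β : Matrix (Fin n) (Fin m) ℝ) (ζ₀ : EuclideanSpace ℝ (Fin n))
    (p : Lp (EuclideanSpace ℝ (Fin m)) 2 (volume.restrict (Icc (0 : ℝ) T)))
    (ζ : ℝ → EuclideanSpace ℝ (Fin n)) : Prop :=
  ContinuousOn ζ (Icc 0 T) ∧ ∀ t ∈ Icc 0 T,
    ζ t = ζ₀ + ∫ τ in (0 : ℝ)..t, (Matrix.toEuclideanLin α (ζ τ) + Matrix.toEuclideanLin β (p τ))

/-- `Π` is a continuous solution on `[0,T]` of the Riccati equation in mild form
`Π(t) = S(t) Π₀ S⋆(t) + ∫₀ᵗ S(t-τ) (Q(τ) - Π(τ) W(τ) Π(τ)) S⋆(t-τ) dτ`. -/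
def IsRiccatiMildSolution {H : Type*} [NormedAddCommGroup H] [InnerProductSpace ℝ H]
    [CompleteSpace H] (T : ℝ) (S : ℝ → H →L[ℝ] H) (Pi0 : H →L[ℝ] H)
    (Q W Pi : ℝ → H →L[ℝ] H) : Prop :=
  ContinuousOn Pi (Icc 0 T) ∧ ∀ t ∈ Icc 0 T,
    Pi t = S t ∘L Pi0 ∘L ContinuousLinearMap.adjoint (S t) +
      ∫ τ in (0 : ℝ)..t, S (t - τ) ∘L (Q τ - Pi τ ∘L W τ ∘L Pi τ) ∘L
        ContinuousLinearMap.adjoint (S (t - τ))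

/-- The admissible guidance functions `L²([0,T]; P)`. -/
def admissibleGuidance {m : ℕ} (T : ℝ) (P : Set (EuclideanSpace ℝ (Fin m))) :
    Set (Lp (EuclideanSpace ℝ (Fin m)) 2 (volume.restrict (Icc (0 : ℝ) T))) :=
  {p | ∀ᵐ t ∂(volume.restrict (Icc (0 : ℝ) T)), p t ∈ P}

/-- The cost `∫₀ᵀ (Tr Π(t) + h(ζ(t),t) + g(p(t),t)) dt + h_f(ζ(T))`, with values in `[0,∞]`. -/
def guidanceCost {H : Type*} [NormedAddCommGroup H] [InnerProductSpace ℝ H] [CompleteSpace H]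
    {n m : ℕ} (T : ℝ) (h : EuclideanSpace ℝ (Fin n) → ℝ → ℝ)
    (g : EuclideanSpace ℝ (Fin m) → ℝ → ℝ) (hf : EuclideanSpace ℝ (Fin n) → ℝ)
    (p : Lp (EuclideanSpace ℝ (Fin m)) 2 (volume.restrict (Icc (0 : ℝ) T)))
    (ζ : ℝ → EuclideanSpace ℝ (Fin n)) (Pi : ℝ → H →L[ℝ] H) : ℝ≥0∞ :=
  (∫⁻ t in Icc 0 T,
    (opTrace (Pi t) + ENNReal.ofReal (h (ζ t) t) + ENNReal.ofReal (g (p t) t))) +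
    ENNReal.ofReal (hf (ζ T))

end HilbertSpace

end

/-!
The covariance equation is solved, and shown to depend continuously on the sensor state, in a form
in which the semigroup has disappeared; the direct method of the calculus of variations then gives
the optimal guidance.

**Removing the semigroup.** Whichever way the approximate semigroup `S` is obtained, it is norm
continuous on `[0,∞)` and `S 0` is the orthogonal projection `P` onto the approximation space. Hence
`Σ(t) = S(t) + (1 - P)` is a norm continuous semigroup with `Σ(0) = 1`, and all its values are
invertible. With `X(t) = Σ(t)⁻¹ Π(t) Σ(t)⁻⋆` the mild Riccati equation becomes `X' = Q̃ - X W̃ X`,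
`X(0) = Π₀`, where `Q̃` is integrable and nonnegative and `W̃` is bounded and nonnegative
(`IsRiccatiMildSolution.solvesRiccati`, `SolvesRiccati.isRiccatiMildSolution`). This equation is
studied in operator norm, to which integrability in a Schatten norm passes by `‖B‖ ≤ ‖B‖_{𝒥_q}`.

**The equation `X' = Q - X W X`.** Truncating `X` radially makes the right-hand side Lipschitz, and
the truncated equation has a unique solution (`exists_volterra_solution`), which is self-adjoint
because its adjoint solves the same equation. The truncation only rescales the coefficient, so the
solution solves `X' = Q - X V X` with `V` nonnegative. If `y' = ½ V X y`, then
`⟪y, X y⟫' = ⟪y, Q y⟫ ≥ 0`; as `y` may take any value at the final time, `X` is nonnegative (`isPositive_of_riccati`).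
Then `X V X` is nonnegative as well, whence `‖X‖ ≤ ‖X₀‖ + ∫ ‖Q‖` (`norm_le_of_riccati`), and with a
truncation radius above this bound the truncation was void. The bound does not depend on `W`, and
Gronwall's inequality shows that solutions depend continuously on `W` in `L¹`
(`SolvesRiccati.tendsto`); uniqueness is a special case.

**Optimal guidance.** Coercivity makes a minimizing sequence `pₖ` bounded in `L²`, and a subsequence
converges weakly to some `p`, which is admissible since the admissible set is closed and convex. The
primitives of `pₖ` converge pointwise and boundedly, hence so do the sensor trajectories
(`SolvesLinear.tendsto_of_weak`). By the modulus of continuity of the output kernels the output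
operators converge in operator norm, with a uniform bound (`outputOp_tendsto_of_trajectories`), and
therefore the covariances converge at every time. The trace is continuous on operators that live on
the finite-dimensional approximation space, so Fatou's lemma handles the trace and the cost of the
sensor state. The cost of the guidance is convex and strongly lower semicontinuous, hence weakly
lower semicontinuous (`running_le_liminf_of_weak`). So the limit `p` is optimal; the optimal cost is
finite because constant guidance has finite cost.
-/

noncomputable section

/-! ### Volterra integral equations -/

/-- Gronwall's inequality in integral form. -/
theorem gronwall_integral {T L δ : ℝ} (hL : 0 ≤ L) {u : ℝ → ℝ}
    (hu : ContinuousOn u (Icc 0 T))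
    (h : ∀ t ∈ Icc 0 T, u t ≤ δ + L * ∫ τ in (0 : ℝ)..t, u τ) :
    ∀ t ∈ Icc 0 T, u t ≤ δ * Real.exp (L * t) := by
  intro t ht
  have hT : 0 ≤ T := ht.1.trans ht.2
  set w : ℝ → ℝ := IccExtend hT ((Icc 0 T).domRestrict u) with hw
  have hwc : Continuous w := hu.domRestrict.Icc_extend'
  have hwu : ∀ s ∈ Icc 0 T, w s = u s := fun s hs => by
    rw [hw, IccExtend_of_mem hT _ hs]; rfl
  have hint : ∀ s ∈ Icc 0 T, ∫ τ in (0 : ℝ)..s, w τ = ∫ τ in (0 : ℝ)..s, u τ := fun s hs =>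
    intervalIntegral.integral_congr fun τ hτ => by
      rw [uIcc_of_le hs.1] at hτ
      exact hwu τ ⟨hτ.1, hτ.2.trans hs.2⟩
  set G : ℝ → ℝ := fun s => δ + L * ∫ τ in (0 : ℝ)..s, w τ with hG
  have hder : ∀ s, HasDerivAt G (L * w s) s := fun s =>
    ((hwc.integral_hasStrictDerivAt 0 s).hasDerivAt.const_mul L).const_add δ
  have key := le_gronwallBound_of_liminf_deriv_right_le (f := G) (f' := fun s => L * w s)
    (δ := δ) (K := L) (ε := 0) (a := 0) (b := T)
    (fun s _ => (hder s).continuousAt.continuousWithinAt)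
    (fun s _ r hr => (hder s).hasDerivWithinAt.liminf_right_slope_le hr)
    (by simp [hG])
    (fun s hs => by
      have hs' : s ∈ Icc 0 T := ⟨hs.1, hs.2.le⟩
      have := h s hs'
      rw [← hint s hs', ← hwu s hs'] at this
      simpa [hG] using mul_le_mul_of_nonneg_left this hL) t ht
  rw [gronwallBound_ε0, sub_zero] at key
  have := h t ht
  rw [← hint t ht] at this
  exact this.trans key

section Volterra

variable {E : Type*} [NormedAddCommGroup E]

theorem intervalIntegrable_of_integrableOn_Icc {T : ℝ} {f : ℝ → E}
    (hf : IntegrableOn f (Icc 0 T)) {s t : ℝ} (hs : s ∈ Icc 0 T) (ht : t ∈ Icc 0 T) :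
    IntervalIntegrable f volume s t := by
  rw [intervalIntegrable_iff]
  exact hf.mono_set (uIoc_subset_uIcc.trans (uIcc_subset_Icc hs ht))

theorem ae_of_ae_restrict_Icc {T : ℝ} {p : ℝ → Prop}
    (h : ∀ᵐ τ ∂(volume.restrict (Icc 0 T)), p τ) : ∀ᵐ τ, τ ∈ Icc 0 T → p τ :=
  (ae_restrict_iff' measurableSet_Icc).1 h

/-- Gronwall's inequality for the norm of a vector-valued function. -/
theorem norm_le_gronwall {T L δ : ℝ} (hL : 0 ≤ L) {x : ℝ → E}
    (hx : ContinuousOn x (Icc 0 T)) (h : ∀ t ∈ Icc 0 T, ‖x t‖ ≤ δ + ∫ τ in (0 : ℝ)..t, L * ‖x τ‖) :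
    ∀ t ∈ Icc 0 T, ‖x t‖ ≤ δ * Real.exp (L * t) :=
  gronwall_integral hL hx.norm fun t ht => by
    simpa only [intervalIntegral.integral_const_mul] using h t ht

variable [NormedSpace ℝ E]

theorem volterra_unique {T : ℝ} {L : ℝ} (hL : 0 ≤ L) {F : ℝ → E → E}
    (hint : ∀ x : ℝ → E, ContinuousOn x (Icc 0 T) →
      IntegrableOn (fun τ => F τ (x τ)) (Icc 0 T))
    (hlip : ∀ᵐ τ ∂(volume.restrict (Icc 0 T)), ∀ x y, ‖F τ x - F τ y‖ ≤ L * ‖x - y‖)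
    {x₀ : E} {x y : ℝ → E} (hx : ContinuousOn x (Icc 0 T)) (hy : ContinuousOn y (Icc 0 T))
    (hxe : ∀ t ∈ Icc 0 T, x t = x₀ + ∫ τ in (0 : ℝ)..t, F τ (x τ))
    (hye : ∀ t ∈ Icc 0 T, y t = x₀ + ∫ τ in (0 : ℝ)..t, F τ (y τ)) :
    EqOn x y (Icc 0 T) := by
  intro t ht
  have hT : (0 : ℝ) ∈ Icc 0 T := ⟨le_rfl, ht.1.trans ht.2⟩
  have key := norm_le_gronwall (δ := 0) hL (hx.sub hy) (fun t ht => by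
    have h0 : x t - y t = ∫ τ in (0 : ℝ)..t, (F τ (x τ) - F τ (y τ)) := by
      rw [intervalIntegral.integral_sub (intervalIntegrable_of_integrableOn_Icc (hint x hx) hT ht)
        (intervalIntegrable_of_integrableOn_Icc (hint y hy) hT ht), hxe t ht, hye t ht]
      abel
    rw [zero_add]
    change ‖x t - y t‖ ≤ _
    rw [h0]
    refine intervalIntegral.norm_integral_le_of_norm_le ht.1 ?_ ?_
    · filter_upwards [ae_of_ae_restrict_Icc hlip] with τ hτ hm
      exact hτ ⟨hm.1.le, hm.2.trans ht.2⟩ _ _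
    · refine intervalIntegrable_of_integrableOn_Icc (T := T) ?_ hT ht
      exact ((hx.sub hy).norm.const_smul L).integrableOn_Icc) t ht
  simpa [sub_eq_zero] using key

/-- A Lipschitz Volterra equation has a solution on the whole interval: some iterate of the Picard
operator is a contraction of the space of continuous functions. -/
theorem exists_volterra_solution [CompleteSpace E] {T : ℝ} (hT : 0 ≤ T) {L : ℝ} (hL : 0 ≤ L)
    {F : ℝ → E → E}
    (hint : ∀ x : ℝ → E, ContinuousOn x (Icc 0 T) →
      IntegrableOn (fun τ => F τ (x τ)) (Icc 0 T))
    (hlip : ∀ᵐ τ ∂(volume.restrict (Icc 0 T)), ∀ x y, ‖F τ x - F τ y‖ ≤ L * ‖x - y‖)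
    (x₀ : E) : ∃ x : ℝ → E, ContinuousOn x (Icc 0 T) ∧
      ∀ t ∈ Icc 0 T, x t = x₀ + ∫ τ in (0 : ℝ)..t, F τ (x τ) := by
  have h0T : (0 : ℝ) ∈ Icc 0 T := ⟨le_rfl, hT⟩
  have hcont : ∀ x : C(Icc 0 T, E), ContinuousOn (IccExtend hT x) (Icc 0 T) := fun x =>
    (x.continuous.Icc_extend').continuousOn
  let Ψ : C(Icc 0 T, E) → C(Icc 0 T, E) := fun x =>
    ⟨fun t => x₀ + ∫ τ in (0 : ℝ)..t, F τ (IccExtend hT x τ), by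
      have := intervalIntegral.continuousOn_primitive_interval (μ := volume) (a := 0) (b := T)
        (f := fun τ => F τ (IccExtend hT x τ)) (by rw [uIcc_of_le hT]; exact hint _ (hcont x))
      rw [uIcc_of_le hT] at this
      exact continuous_const.add (continuousOn_iff_continuous_domRestrict.1 this)⟩
  have hΨ : ∀ x t, Ψ x t = x₀ + ∫ τ in (0 : ℝ)..t, F τ (IccExtend hT x τ) := fun _ _ => rfl
  have hiter : ∀ (k : ℕ) (x y : C(Icc 0 T, E)) (t : Icc 0 T),
      ‖Ψ^[k] x t - Ψ^[k] y t‖ ≤ (L * t) ^ k / k.factorial * dist x y := by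
    intro k x y
    induction k with
    | zero =>
      intro t
      simpa [← dist_eq_norm] using ContinuousMap.dist_apply_le_dist (f := x) (g := y) t
    | succ k ih =>
      intro t
      set a := Ψ^[k] x
      set b := Ψ^[k] y
      rw [Function.iterate_succ_apply', Function.iterate_succ_apply', hΨ, hΨ,
        add_sub_add_left_eq_sub, ← intervalIntegral.integral_sub
        (intervalIntegrable_of_integrableOn_Icc (hint _ (hcont a)) h0T t.2)
        (intervalIntegrable_of_integrableOn_Icc (hint _ (hcont b)) h0T t.2)]
      have hval : ∫ τ in (0 : ℝ)..t, L * ((L * τ) ^ k / k.factorial * dist x y) =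
          (L * t) ^ (k + 1) / (k + 1).factorial * dist x y := by
        have : (fun τ : ℝ => L * ((L * τ) ^ k / k.factorial * dist x y)) =
            fun τ => (L ^ (k + 1) / k.factorial * dist x y) * τ ^ k := by
          funext τ; ring
        rw [this, intervalIntegral.integral_const_mul, integral_pow, Nat.factorial_succ]
        have := Nat.factorial_ne_zero k
        push_cast
        rw [mul_pow]
        field_simp
        simp
      rw [← hval]
      refine intervalIntegral.norm_integral_le_of_norm_le t.2.1 ?_
        (Continuous.intervalIntegrable (by fun_prop) _ _)
      filter_upwards [ae_of_ae_restrict_Icc hlip] with τ hτ hm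
      have hτ' : τ ∈ Icc 0 T := ⟨hm.1.le, hm.2.trans t.2.2⟩
      refine (hτ hτ' _ _).trans (mul_le_mul_of_nonneg_left ?_ hL)
      rw [IccExtend_of_mem hT _ hτ', IccExtend_of_mem hT _ hτ']
      exact ih ⟨τ, hτ'⟩
  obtain ⟨k, hk⟩ := ((FloorSemiring.tendsto_pow_div_factorial_atTop (L * T)).eventually_lt_const
    zero_lt_one).exists
  have hk0 : 0 ≤ (L * T) ^ k / (k.factorial : ℝ) := by positivity
  -- an iterate whose Lipschitz constant `(L T)ᵏ / k!` is less than one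
  have hcontr : ContractingWith ⟨_, hk0⟩ Ψ^[k] := by
    refine ⟨by exact_mod_cast hk, LipschitzWith.of_dist_le_mul fun x y => ?_⟩
    refine (ContinuousMap.dist_le (by positivity)).2 fun t => ?_
    rw [dist_eq_norm]
    refine (hiter k x y t).trans ?_
    have h1 := t.2.1
    have h2 := t.2.2
    change _ ≤ (L * T) ^ k / (k.factorial : ℝ) * dist x y
    gcongr
  have hfix := hcontr.isFixedPt_fixedPoint_iterate
  set z := ContractingWith.fixedPoint _ hcontr
  refine ⟨IccExtend hT z, hcont z, fun t ht => ?_⟩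
  rw [IccExtend_of_mem hT _ ht]
  conv_lhs => rw [← show Ψ z = z from hfix]
  exact hΨ z ⟨t, ht⟩

theorem ae_hasDerivAt_of_eq_integral [CompleteSpace E] {T : ℝ} {f f' : ℝ → E}
    (hf' : IntegrableOn f' (Icc 0 T))
    (h : ∀ t ∈ Icc 0 T, f t = f 0 + ∫ τ in (0 : ℝ)..t, f' τ) :
    ∀ᵐ s, s ∈ Ioo 0 T → HasDerivAt f (f' s) s := by
  rcases le_or_gt T 0 with hT | hT
  · exact Eventually.of_forall fun s hs => absurd (hs.1.trans hs.2) (not_lt.2 hT)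
  have hI : IntervalIntegrable f' volume 0 T :=
    intervalIntegrable_of_integrableOn_Icc hf' ⟨le_rfl, hT.le⟩ ⟨hT.le, le_rfl⟩
  filter_upwards [hI.ae_hasDerivAt_integral] with s hs hm
  rw [uIcc_of_le hT.le] at hs
  have := (hs (Ioo_subset_Icc_self hm) 0 ⟨le_rfl, hT.le⟩).const_add (f 0)
  refine this.congr_of_eventuallyEq ?_
  filter_upwards [Ioo_mem_nhds hm.1 hm.2] with r hr
  exact h r (Ioo_subset_Icc_self hr)

theorem norm_sub_le_of_eq_integral {T : ℝ} {f f' : ℝ → E}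
    (hf' : IntegrableOn f' (Icc 0 T))
    (h : ∀ t ∈ Icc 0 T, f t = f 0 + ∫ τ in (0 : ℝ)..t, f' τ) {r s : ℝ} (hr : r ∈ Icc 0 T)
    (hs : s ∈ Icc 0 T) (hrs : r ≤ s) : ‖f s - f r‖ ≤ ∫ τ in r..s, ‖f' τ‖ := by
  have h0 : (0 : ℝ) ∈ Icc 0 T := ⟨le_rfl, hr.1.trans hr.2⟩
  rw [h s hs, h r hr, add_sub_add_left_eq_sub, intervalIntegral.integral_interval_sub_left
    (intervalIntegrable_of_integrableOn_Icc hf' h0 hs)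
    (intervalIntegrable_of_integrableOn_Icc hf' h0 hr)]
  exact intervalIntegral.norm_integral_le_integral_norm hrs

/-- The terminal value problem `y' = A y`, `y(t) = x` on `[0,t]`, obtained from the initial value
problem by reversing time. -/
theorem exists_backward_linear_solution [CompleteSpace E] {t K : ℝ} (ht : 0 ≤ t)
    {A : ℝ → E →L[ℝ] E} (hAm : AEStronglyMeasurable A (volume.restrict (Icc 0 t)))
    (hAb : ∀ᵐ τ ∂(volume.restrict (Icc 0 t)), ‖A τ‖ ≤ K) (x : E) :
    ∃ y : ℝ → E, ContinuousOn y (Icc 0 t) ∧ y t = x ∧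
      IntegrableOn (fun τ => A τ (y τ)) (Icc 0 t) ∧
      ∀ s ∈ Icc 0 t, y s = y 0 + ∫ τ in (0 : ℝ)..s, A τ (y τ) := by
  have hint : ∀ z : ℝ → E, ContinuousOn z (Icc 0 t) →
      IntegrableOn (fun τ => A τ (z τ)) (Icc 0 t) := by
    intro z hz
    obtain ⟨c, hc⟩ := isCompact_Icc.exists_bound_of_continuousOn hz
    refine Integrable.of_bound (isBoundedBilinearMap_apply.continuous.comp_aestronglyMeasurable
      (hAm.prodMk (hz.aestronglyMeasurable measurableSet_Icc)))
      (K * c) ?_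
    filter_upwards [hAb, ae_restrict_mem measurableSet_Icc] with τ hτ hm
    exact (A τ).le_of_opNorm_le_of_le hτ (hc τ hm)
  have hpre : (fun τ : ℝ => t - τ) ⁻¹' Icc 0 t = Icc 0 t := by
    ext τ
    simp [and_comm]
  have hmp : MeasurePreserving (fun τ : ℝ => t - τ) (volume.restrict (Icc 0 t))
      (volume.restrict (Icc 0 t)) := by
    have := (Measure.measurePreserving_sub_left volume t).restrict_preimage
      (measurableSet_Icc (a := (0 : ℝ)) (b := t))
    rwa [hpre] at this
  have hflip : ∀ {z : ℝ → E}, ContinuousOn z (Icc 0 t) →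
      ContinuousOn (fun s => z (t - s)) (Icc 0 t) := fun {z} hz =>
    hz.comp (by fun_prop) fun s hs => by rw [← hpre] at hs; exact hs
  obtain ⟨z, hz, hze⟩ := exists_volterra_solution (F := fun ρ u => -(A (t - ρ) u))
    (L := max K 0) ht (le_max_right _ _)
    (fun z hz => by
      have h1 := (hmp.integrable_comp_of_integrable (hint _ (hflip hz))).neg
      refine h1.congr (Eventually.of_forall fun s => ?_)
      simp [Function.comp_def])
    (by
      filter_upwards [hmp.quasiMeasurePreserving.ae hAb] with τ hτ u v
      rw [neg_sub_neg, ← map_sub, norm_sub_rev u v]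
      exact (A (t - τ)).le_of_opNorm_le (hτ.trans (le_max_left _ _)) _)
    x
  have hI := hint _ (hflip hz)
  have h0 : (0 : ℝ) ∈ Icc 0 t := ⟨le_rfl, ht⟩
  have ht' : t ∈ Icc 0 t := ⟨ht, le_rfl⟩
  have hy : ∀ s ∈ Icc 0 t, z (t - s) = x - ∫ τ in s..t, A τ (z (t - τ)) := by
    intro s hs
    rw [hze (t - s) (by rw [← hpre] at hs; exact hs)]
    have := intervalIntegral.integral_comp_sub_left (a := 0) (b := t - s)
      (fun σ => A σ (z (t - σ))) t
    simp only [sub_sub_cancel, sub_zero] at this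
    rw [intervalIntegral.integral_neg, this, sub_eq_add_neg]
  refine ⟨fun s => z (t - s), hflip hz, ?_, hI, fun s hs => ?_⟩
  · simp [hze 0 h0]
  · beta_reduce
    rw [hy s hs, hy 0 h0, ← intervalIntegral.integral_add_adjacent_intervals
      (intervalIntegrable_of_integrableOn_Icc hI h0 hs)
      (intervalIntegrable_of_integrableOn_Icc hI hs ht')]
    abel

end Volterra

/-- A function with an integrable modulus of absolute continuity and an almost everywhere
nonnegative derivative does not decrease. -/
theorem le_of_ae_hasDerivAt_nonneg {φ k : ℝ → ℝ} {t : ℝ} (ht : 0 ≤ t)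
    (hk : IntervalIntegrable k volume 0 t)
    (hφ : ∀ r ∈ Icc 0 t, ∀ s ∈ Icc 0 t, r ≤ s → |φ s - φ r| ≤ ∫ τ in r..s, k τ)
    (hd : ∀ᵐ s, s ∈ Ioo 0 t → ∃ d, 0 ≤ d ∧ HasDerivAt φ d s) : φ 0 ≤ φ t := by
  have hm := hk.absolutelyContinuousOnInterval_intervalIntegral (c := 0) (by simp)
  have hsub : ∀ r ∈ Icc 0 t, ∀ s ∈ Icc 0 t,
      (∫ τ in (0 : ℝ)..s, k τ) - (∫ τ in (0 : ℝ)..r, k τ) = ∫ τ in r..s, k τ := by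
    intro r hr s hs
    have hki : IntegrableOn k (Icc 0 t) := by
      rwa [intervalIntegrable_iff_integrableOn_Icc_of_le ht] at hk
    exact intervalIntegral.integral_interval_sub_left
      (intervalIntegrable_of_integrableOn_Icc hki ⟨le_rfl, ht⟩ hs)
      (intervalIntegrable_of_integrableOn_Icc hki ⟨le_rfl, ht⟩ hr)
  have hdist : ∀ r ∈ Icc 0 t, ∀ s ∈ Icc 0 t, dist (φ r) (φ s) ≤
      dist (∫ τ in (0 : ℝ)..r, k τ) (∫ τ in (0 : ℝ)..s, k τ) := by
    intro r hr s hs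
    rcases le_total r s with h | h
    · rw [dist_comm, Real.dist_eq, dist_comm, Real.dist_eq, hsub r hr s hs]
      exact (hφ r hr s hs h).trans (le_abs_self _)
    · rw [Real.dist_eq, Real.dist_eq, hsub s hs r hr]
      exact (hφ s hs r hr h).trans (le_abs_self _)
  have hac : AbsolutelyContinuousOnInterval φ 0 t := by
    rw [absolutelyContinuousOnInterval_iff] at hm ⊢
    intro ε hε
    obtain ⟨δ, hδ, H⟩ := hm ε hε
    refine ⟨δ, hδ, fun E hE hlt => lt_of_le_of_lt (Finset.sum_le_sum fun i hi => ?_) (H E hE hlt)⟩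
    have := hE.1 i (by simpa using hi)
    rw [uIcc_of_le ht] at this
    exact hdist _ this.1 _ this.2
  have := hac.integral_deriv_eq_sub
  have h2 : 0 ≤ ∫ x in (0 : ℝ)..t, deriv φ x := by
    refine intervalIntegral.integral_nonneg_of_ae_restrict ht ?_
    rw [← restrict_Ioo_eq_restrict_Icc, EventuallyLE, ae_restrict_iff' measurableSet_Ioo]
    filter_upwards [hd] with s hs hm
    obtain ⟨d, hd0, hd⟩ := hs hm
    simpa [hd.deriv] using hd0
  linarith

/-! ### Radial truncation -/

/-- The radial retraction of a normed space onto its closed ball of radius `K > 0`. -/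
def radialCut {E : Type*} [NormedAddCommGroup E] [NormedSpace ℝ E] (K : ℝ) (x : E) : E :=
  (K / max K ‖x‖) • x

section RadialCut

variable {E : Type*} [NormedAddCommGroup E] {K : ℝ}

theorem radialCut_coeff_nonneg (hK : 0 < K) (x : E) : 0 ≤ K / max K ‖x‖ := by positivity

theorem radialCut_coeff_le_one (hK : 0 < K) (x : E) : K / max K ‖x‖ ≤ 1 :=
  div_le_one_of_le₀ (le_max_left _ _) (by positivity)

variable [NormedSpace ℝ E]

theorem norm_radialCut_le (hK : 0 < K) (x : E) : ‖radialCut K x‖ ≤ K := by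
  have h : 0 < max K ‖x‖ := lt_max_of_lt_left hK
  rw [radialCut, norm_smul, Real.norm_of_nonneg (radialCut_coeff_nonneg hK x), div_mul_eq_mul_div,
    div_le_iff₀ h]
  exact mul_le_mul_of_nonneg_left (le_max_right _ _) hK.le

theorem norm_radialCut_sub_le (hK : 0 < K) (x y : E) :
    ‖radialCut K x - radialCut K y‖ ≤ 2 * ‖x - y‖ := by
  set a := max K ‖x‖ with ha
  set b := max K ‖y‖ with hb
  have ha0 : 0 < a := lt_max_of_lt_left hK
  have hb0 : 0 < b := lt_max_of_lt_left hK
  have h1 : radialCut K x - radialCut K y = (K / a) • (x - y) + (K / a - K / b) • y := by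
    rw [radialCut, radialCut, ← ha, ← hb, smul_sub, sub_smul]
    abel
  have h2 : ‖(K / a) • (x - y)‖ ≤ ‖x - y‖ := by
    rw [norm_smul, Real.norm_of_nonneg (radialCut_coeff_nonneg hK x)]
    exact mul_le_of_le_one_left (norm_nonneg _) (radialCut_coeff_le_one hK x)
  have h3 : ‖(K / a - K / b) • y‖ ≤ ‖x - y‖ := by
    have h4 : K / a - K / b = (K / a) * (b - a) / b := by field_simp
    have h5 : |b - a| ≤ ‖x - y‖ := by
      rw [ha, hb]
      refine (abs_max_sub_max_le_max K ‖y‖ K ‖x‖).trans ?_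
      rw [sub_self, abs_zero, max_eq_right (abs_nonneg _), norm_sub_rev]
      exact abs_norm_sub_norm_le y x
    have h6 : ‖y‖ / b ≤ 1 := div_le_one_of_le₀ (le_max_right _ _) hb0.le
    rw [norm_smul, h4, norm_div, norm_mul, Real.norm_of_nonneg (radialCut_coeff_nonneg hK x),
      Real.norm_eq_abs, Real.norm_of_nonneg hb0.le]
    calc K / a * |b - a| / b * ‖y‖ = (K / a * |b - a|) * (‖y‖ / b) := by ring
      _ ≤ (1 * ‖x - y‖) * 1 := by
        gcongr
        exact radialCut_coeff_le_one hK x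
      _ = ‖x - y‖ := by ring
  rw [h1]
  exact (norm_add_le _ _).trans (by linarith)

theorem continuous_radialCut (hK : 0 < K) : Continuous (radialCut K : E → E) :=
  (LipschitzWith.of_dist_le_mul (K := 2) fun x y => by
    rw [dist_eq_norm, dist_eq_norm]
    exact norm_radialCut_sub_le hK x y).continuous

end RadialCut

/-! ### The Riccati equation without drift -/

section Riccati

variable {H : Type*} [NormedAddCommGroup H] [InnerProductSpace ℝ H]

theorem integrableOn_mul_mul {T w : ℝ} {W X Y : ℝ → H →L[ℝ] H}
    (hWm : AEStronglyMeasurable W (volume.restrict (Icc 0 T)))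
    (hWb : ∀ᵐ τ ∂(volume.restrict (Icc 0 T)), ‖W τ‖ ≤ w)
    (hX : ContinuousOn X (Icc 0 T)) (hY : ContinuousOn Y (Icc 0 T)) :
    IntegrableOn (fun τ => X τ * W τ * Y τ) (Icc 0 T) := by
  obtain ⟨c, hc⟩ := isCompact_Icc.exists_bound_of_continuousOn hX
  obtain ⟨d, hd⟩ := isCompact_Icc.exists_bound_of_continuousOn hY
  refine Integrable.of_bound (((hX.aestronglyMeasurable measurableSet_Icc).mul hWm).mul
    (hY.aestronglyMeasurable measurableSet_Icc)) (c * w * d) ?_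
  filter_upwards [hWb, ae_restrict_mem measurableSet_Icc] with τ hτ hm
  have h1 := hc τ hm
  have h2 := hd τ hm
  have hc0 := (norm_nonneg _).trans h1
  have hw0 := (norm_nonneg _).trans hτ
  calc ‖X τ * W τ * Y τ‖ ≤ ‖X τ‖ * ‖W τ‖ * ‖Y τ‖ := norm_mul₃_le
    _ ≤ c * w * d := by gcongr

/-- `X` is a continuous solution of `X' = Q - X W X`, `X(0) = X₀` on `[0,T]`, in integrated form. -/
def SolvesRiccati (T : ℝ) (X₀ : H →L[ℝ] H) (Q W X : ℝ → H →L[ℝ] H) : Prop :=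
  ContinuousOn X (Icc 0 T) ∧
    ∀ t ∈ Icc 0 T, X t = X₀ + ∫ τ in (0 : ℝ)..t, (Q τ - X τ * W τ * X τ)

/-- Lipschitz dependence of bounded solutions on the quadratic coefficient, in the `L¹` norm. -/
theorem SolvesRiccati.norm_sub_le {T w c w' : ℝ} {X₀ : H →L[ℝ] H} {Q W W' X Y : ℝ → H →L[ℝ] H}
    (hQ : IntegrableOn Q (Icc 0 T))
    (hWm : AEStronglyMeasurable W (volume.restrict (Icc 0 T)))
    (hWb : ∀ᵐ τ ∂(volume.restrict (Icc 0 T)), ‖W τ‖ ≤ w)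
    (hWm' : AEStronglyMeasurable W' (volume.restrict (Icc 0 T)))
    (hWb' : ∀ᵐ τ ∂(volume.restrict (Icc 0 T)), ‖W' τ‖ ≤ w')
    (hX : SolvesRiccati T X₀ Q W X) (hY : SolvesRiccati T X₀ Q W' Y)
    (hXc : ∀ t ∈ Icc 0 T, ‖X t‖ ≤ c) (hYc : ∀ t ∈ Icc 0 T, ‖Y t‖ ≤ c) :
    ∀ t ∈ Icc 0 T, ‖X t - Y t‖ ≤
      c ^ 2 * (∫ τ in Icc 0 T, ‖W τ - W' τ‖) * Real.exp (2 * c * max w 0 * t) := by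
  intro t₁ ht₁
  have hT0 : 0 ≤ T := ht₁.1.trans ht₁.2
  have h0 : (0 : ℝ) ∈ Icc 0 T := ⟨le_rfl, hT0⟩
  have hc0 : 0 ≤ c := (norm_nonneg _).trans (hXc 0 h0)
  have hWW : IntegrableOn (fun τ => ‖W τ - W' τ‖) (Icc 0 T) := by
    refine Integrable.norm (Integrable.of_bound (hWm.sub hWm') (w + w') ?_)
    filter_upwards [hWb, hWb'] with τ h1 h2
    exact (_root_.norm_sub_le _ _).trans (add_le_add h1 h2)
  have hDc : ContinuousOn (fun t => X t - Y t) (Icc 0 T) := hX.1.sub hY.1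
  refine norm_le_gronwall (by positivity) hDc (fun t ht => ?_) t₁ ht₁
  have i1 : IntegrableOn (fun τ => Q τ - X τ * W τ * X τ) (Icc 0 T) :=
    hQ.sub (integrableOn_mul_mul hWm hWb hX.1 hX.1)
  have i2 : IntegrableOn (fun τ => Q τ - Y τ * W' τ * Y τ) (Icc 0 T) :=
    hQ.sub (integrableOn_mul_mul hWm' hWb' hY.1 hY.1)
  have e : X t - Y t = ∫ τ in (0 : ℝ)..t,
      ((Q τ - X τ * W τ * X τ) - (Q τ - Y τ * W' τ * Y τ)) := by
    rw [intervalIntegral.integral_sub (intervalIntegrable_of_integrableOn_Icc i1 h0 ht)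
      (intervalIntegrable_of_integrableOn_Icc i2 h0 ht), hX.2 t ht, hY.2 t ht]
    abel
  have j1 : IntervalIntegrable (fun τ => c ^ 2 * ‖W τ - W' τ‖) volume 0 t :=
    intervalIntegrable_of_integrableOn_Icc (hWW.const_mul _) h0 ht
  have j2 : IntervalIntegrable (fun τ => 2 * c * max w 0 * ‖X τ - Y τ‖) volume 0 t :=
    intervalIntegrable_of_integrableOn_Icc (T := T)
      ((hDc.norm.const_smul (2 * c * max w 0)).integrableOn_Icc) h0 ht
  have hle : ∫ τ in (0 : ℝ)..t, c ^ 2 * ‖W τ - W' τ‖ ≤ c ^ 2 * ∫ τ in Icc 0 T, ‖W τ - W' τ‖ := by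
    rw [intervalIntegral.integral_const_mul, intervalIntegral.integral_of_le ht.1]
    refine mul_le_mul_of_nonneg_left ?_ (by positivity)
    refine setIntegral_mono_set hWW (Eventually.of_forall fun _ => norm_nonneg _) ?_
    exact LE.le.eventuallyLE (Ioc_subset_Icc_self.trans (Icc_subset_Icc_right ht.2))
  refine le_trans ?_ (add_le_add_left hle _)
  rw [← intervalIntegral.integral_add j1 j2, e]
  refine intervalIntegral.norm_integral_le_of_norm_le ht.1 ?_ (j1.add j2)
  filter_upwards [ae_of_ae_restrict_Icc hWb] with τ h1 hm
  have hτ : τ ∈ Icc 0 T := ⟨hm.1.le, hm.2.trans ht.2⟩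
  have e2 : (Q τ - X τ * W τ * X τ) - (Q τ - Y τ * W' τ * Y τ) =
      -(Y τ * (W τ - W' τ) * Y τ + ((X τ - Y τ) * W τ * X τ + Y τ * W τ * (X τ - Y τ))) := by
    noncomm_ring
  have hw : ‖W τ‖ ≤ max w 0 := (h1 hτ).trans (le_max_left _ _)
  have hx := hXc τ hτ
  have hy := hYc τ hτ
  rw [e2, norm_neg]
  refine (norm_add_le _ _).trans (add_le_add ?_ ((norm_add_le _ _).trans ?_))
  · calc ‖Y τ * (W τ - W' τ) * Y τ‖ ≤ ‖Y τ‖ * ‖W τ - W' τ‖ * ‖Y τ‖ := norm_mul₃_le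
      _ ≤ c * ‖W τ - W' τ‖ * c := by gcongr
      _ = _ := by ring
  · have a1 : ‖(X τ - Y τ) * W τ * X τ‖ ≤ ‖X τ - Y τ‖ * max w 0 * c :=
      norm_mul₃_le.trans (by gcongr)
    have a2 : ‖Y τ * W τ * (X τ - Y τ)‖ ≤ c * max w 0 * ‖X τ - Y τ‖ :=
      norm_mul₃_le.trans (by gcongr)
    linarith

theorem SolvesRiccati.eqOn {T w : ℝ} {X₀ : H →L[ℝ] H} {Q W X Y : ℝ → H →L[ℝ] H}
    (hQ : IntegrableOn Q (Icc 0 T))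
    (hWm : AEStronglyMeasurable W (volume.restrict (Icc 0 T)))
    (hWb : ∀ᵐ τ ∂(volume.restrict (Icc 0 T)), ‖W τ‖ ≤ w)
    (hX : SolvesRiccati T X₀ Q W X) (hY : SolvesRiccati T X₀ Q W Y) : EqOn X Y (Icc 0 T) := by
  intro t ht
  obtain ⟨c, hc⟩ := isCompact_Icc.exists_bound_of_continuousOn hX.1
  obtain ⟨d, hd⟩ := isCompact_Icc.exists_bound_of_continuousOn hY.1
  have := hX.norm_sub_le (c := max c d) hQ hWm hWb hWm hWb hY
    (fun s hs => (hc s hs).trans (le_max_left _ _)) (fun s hs => (hd s hs).trans (le_max_right _ _))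
    t ht
  simpa [sub_eq_zero] using this

/-- If the quadratic coefficients are uniformly bounded and converge almost everywhere, then
uniformly bounded solutions converge. -/
theorem SolvesRiccati.tendsto {T w c : ℝ} {X₀ : H →L[ℝ] H} {Q W X : ℝ → H →L[ℝ] H}
    {Wk Xk : ℕ → ℝ → H →L[ℝ] H}
    (hQ : IntegrableOn Q (Icc 0 T))
    (hWm : AEStronglyMeasurable W (volume.restrict (Icc 0 T)))
    (hWb : ∀ᵐ τ ∂(volume.restrict (Icc 0 T)), ‖W τ‖ ≤ w)
    (hWkm : ∀ k, AEStronglyMeasurable (Wk k) (volume.restrict (Icc 0 T)))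
    (hWkb : ∀ k, ∀ᵐ τ ∂(volume.restrict (Icc 0 T)), ‖Wk k τ‖ ≤ w)
    (hlim : ∀ᵐ τ ∂(volume.restrict (Icc 0 T)), Tendsto (fun k => Wk k τ) atTop (𝓝 (W τ)))
    (hX : SolvesRiccati T X₀ Q W X) (hXk : ∀ k, SolvesRiccati T X₀ Q (Wk k) (Xk k))
    (hXc : ∀ t ∈ Icc 0 T, ‖X t‖ ≤ c) (hXkc : ∀ k, ∀ t ∈ Icc 0 T, ‖Xk k t‖ ≤ c)
    {t : ℝ} (ht : t ∈ Icc 0 T) : Tendsto (fun k => Xk k t) atTop (𝓝 (X t)) := by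
  have hI : Tendsto (fun k => ∫ τ in Icc 0 T, ‖W τ - Wk k τ‖) atTop (𝓝 0) := by
    have := tendsto_integral_of_dominated_convergence (μ := volume.restrict (Icc 0 T))
      (F := fun k τ => ‖W τ - Wk k τ‖) (f := fun _ => (0 : ℝ)) (fun _ => w + w)
      (fun k => (hWm.sub (hWkm k)).norm) (integrable_const _)
      (fun k => by
        filter_upwards [hWb, hWkb k] with τ h1 h2
        rw [norm_norm]
        exact (_root_.norm_sub_le _ _).trans (add_le_add h1 h2))
      (by
        filter_upwards [hlim] with τ hτ
        simpa using (tendsto_const_nhds (x := W τ)).sub hτ |>.norm)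
    simpa using this
  rw [tendsto_iff_norm_sub_tendsto_zero]
  refine squeeze_zero (fun _ => norm_nonneg _) (fun k => ?_)
    (g := fun k => c ^ 2 * (∫ τ in Icc 0 T, ‖W τ - Wk k τ‖) * Real.exp (2 * c * max w 0 * t)) ?_
  · rw [norm_sub_rev]
    exact hX.norm_sub_le hQ hWm hWb (hWkm k) (hWkb k) (hXk k) hXc (hXkc k) t ht
  · simpa using (hI.const_mul (c ^ 2)).mul_const (Real.exp (2 * c * max w 0 * t))

theorem norm_le_of_inner_le {A : H →L[ℝ] H} (hA : A.IsPositive) {K : ℝ} (hK : 0 ≤ K)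
    (h : ∀ x, inner ℝ x (A x) ≤ K * ‖x‖ ^ 2) : ‖A‖ ≤ K := by
  rw [A.norm_eq_iSup_rayleighQuotient hA.isSymmetric]
  refine Real.iSup_le (fun x => ?_) hK
  rw [ContinuousLinearMap.rayleighQuotient, ContinuousLinearMap.reApplyInnerSelf_apply,
    RCLike.re_to_real, real_inner_comm,
    abs_of_nonneg (div_nonneg (hA.inner_nonneg_right x) (by positivity))]
  exact div_le_of_le_mul₀ (by positivity) hK (h x)

variable [CompleteSpace H]

theorem IsSelfAdjoint.inner_apply_comm {A : H →L[ℝ] H} (hA : IsSelfAdjoint A) (x y : H) :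
    inner ℝ (A x) y = inner ℝ x (A y) :=
  hA.isSymmetric x y

theorem isPositive_of_inner_nonneg {A : H →L[ℝ] H} (hA : IsSelfAdjoint A)
    (h : ∀ x, 0 ≤ inner ℝ x (A x)) : A.IsPositive := by
  refine ContinuousLinearMap.isPositive_def.2 ⟨hA.isSymmetric, fun x => ?_⟩
  simpa [ContinuousLinearMap.reApplyInnerSelf_apply, real_inner_comm] using h x

/-- A self-adjoint solution of `X' = Q - X V X` that starts at a positive operator stays positive:
if `y' = ½ V X y` then `⟪y, X y⟫' = ⟪y, Q y⟫ ≥ 0`, and `y` can be given any terminal value. No sign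
condition on `V` is needed. -/
theorem isPositive_of_riccati {T w : ℝ} {X₀ : H →L[ℝ] H} {Q V X : ℝ → H →L[ℝ] H}
    (hX₀ : X₀.IsPositive) (hQ : IntegrableOn Q (Icc 0 T))
    (hQp : ∀ t ∈ Icc 0 T, (Q t).IsPositive)
    (hVm : AEStronglyMeasurable V (volume.restrict (Icc 0 T)))
    (hVb : ∀ᵐ τ ∂(volume.restrict (Icc 0 T)), ‖V τ‖ ≤ w)
    (hX : ContinuousOn X (Icc 0 T)) (hXs : ∀ t ∈ Icc 0 T, IsSelfAdjoint (X t))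
    (hXe : ∀ t ∈ Icc 0 T, X t = X₀ + ∫ τ in (0 : ℝ)..t, (Q τ - X τ * V τ * X τ)) :
    ∀ t ∈ Icc 0 T, (X t).IsPositive := by
  intro t ht
  refine isPositive_of_inner_nonneg (hXs t ht) fun x => ?_
  have hsub : Icc 0 t ⊆ Icc 0 T := Icc_subset_Icc_right ht.2
  have h0 : (0 : ℝ) ∈ Icc 0 t := ⟨le_rfl, ht.1⟩
  have htt : t ∈ Icc 0 t := ⟨ht.1, le_rfl⟩
  have hμ : volume.restrict (Icc 0 t) ≤ volume.restrict (Icc 0 T) :=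
    Measure.restrict_mono_set _ hsub
  obtain ⟨cX, hcX⟩ := isCompact_Icc.exists_bound_of_continuousOn hX
  have hcX0 : 0 ≤ cX := (norm_nonneg _).trans (hcX t ht)
  have hXt := hX.mono hsub
  have hD : IntegrableOn (fun τ => Q τ - X τ * V τ * X τ) (Icc 0 t) :=
    (hQ.sub (integrableOn_mul_mul hVm hVb hX hX)).mono_set hsub
  have hX0 : X 0 = X₀ := by rw [hXe 0 (hsub h0)]; simp
  have hXe' : ∀ s ∈ Icc 0 t, X s = X 0 + ∫ τ in (0 : ℝ)..s, (Q τ - X τ * V τ * X τ) :=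
      fun s hs => by
    rw [hX0]; exact hXe s (hsub hs)
  -- the test curve `y' = ½ V X y` that ends at `x`
  obtain ⟨y, hy, hyt, hyI, hye⟩ := exists_backward_linear_solution
    (A := fun τ => (2⁻¹ : ℝ) • (V τ * X τ))
    (K := 2⁻¹ * (w * cX)) ht.1
    (((hVm.mono_measure hμ).fun_mul (hXt.aestronglyMeasurable measurableSet_Icc)).fun_const_smul _)
    (by
      filter_upwards [ae_mono hμ hVb, ae_restrict_mem measurableSet_Icc] with τ hτ hm
      rw [norm_smul, Real.norm_of_nonneg (by norm_num)]
      have := (norm_nonneg _).trans hτ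
      gcongr
      exact (norm_mul_le _ _).trans (mul_le_mul hτ (hcX τ (hsub hm)) (norm_nonneg _) this)) x
  obtain ⟨cy, hcy⟩ := isCompact_Icc.exists_bound_of_continuousOn hy
  have hcy0 : 0 ≤ cy := (norm_nonneg _).trans (hcy t htt)
  set Y' : ℝ → H := fun τ => ((2⁻¹ : ℝ) • (V τ * X τ)) (y τ) with hY'
  set X' : ℝ → H →L[ℝ] H := fun τ => Q τ - X τ * V τ * X τ with hX'
  have key := le_of_ae_hasDerivAt_nonneg (φ := fun s => inner ℝ (y s) (X s (y s)))
    (k := fun τ => 2 * (cX * cy) * ‖Y' τ‖ + cy * cy * ‖X' τ‖) ht.1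
    (by
      refine intervalIntegrable_of_integrableOn_Icc (T := t) ?_ h0 htt
      exact (hyI.norm.const_mul _).add (hD.norm.const_mul _))
    (by
      intro r hr s hs hrs
      have hi1 : IntervalIntegrable (fun τ => ‖Y' τ‖) volume r s :=
        intervalIntegrable_of_integrableOn_Icc hyI.norm hr hs
      have hi2 : IntervalIntegrable (fun τ => ‖X' τ‖) volume r s :=
        intervalIntegrable_of_integrableOn_Icc hD.norm hr hs
      rw [intervalIntegral.integral_add (hi1.const_mul _) (hi2.const_mul _),
        intervalIntegral.integral_const_mul, intervalIntegral.integral_const_mul]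
      have e1 := norm_sub_le_of_eq_integral hyI hye hr hs hrs
      have e2 := norm_sub_le_of_eq_integral hD hXe' hr hs hrs
      -- the increments of `⟪y, X y⟫` are controlled by those of `y` and `X`
      have e3 : inner ℝ (y s) (X s (y s)) - inner ℝ (y r) (X r (y r)) =
          inner ℝ (y s - y r) (X s (y s)) + inner ℝ (y r) ((X s - X r) (y s)) +
          inner ℝ (y r) (X r (y s - y r)) := by
        simp only [inner_sub_left, inner_sub_right, sub_apply, map_sub]
        ring
      have b1 : ‖X s (y s)‖ ≤ cX * cy := (X s).le_of_opNorm_le_of_le (hcX s (hsub hs)) (hcy s hs)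
      have b2 : ‖(X s - X r) (y s)‖ ≤ ‖X s - X r‖ * cy :=
        (X s - X r).le_of_opNorm_le_of_le le_rfl (hcy s hs)
      have b3 : ‖X r (y s - y r)‖ ≤ cX * ‖y s - y r‖ := (X r).le_of_opNorm_le (hcX r (hsub hr)) _
      rw [e3]
      refine (abs_add_three _ _ _).trans ?_
      have a1 := (abs_real_inner_le_norm (y s - y r) (X s (y s))).trans
        (mul_le_mul_of_nonneg_left b1 (norm_nonneg _))
      have a2 := (abs_real_inner_le_norm (y r) ((X s - X r) (y s))).trans
        (mul_le_mul (hcy r hr) b2 (norm_nonneg _) hcy0)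
      have a3 := (abs_real_inner_le_norm (y r) (X r (y s - y r))).trans
        (mul_le_mul (hcy r hr) b3 (norm_nonneg _) hcy0)
      have f1 := mul_le_mul_of_nonneg_left e1 (mul_nonneg hcX0 hcy0)
      have f2 := mul_le_mul_of_nonneg_left e2 (mul_nonneg hcy0 hcy0)
      nlinarith [a1, a2, a3, f1, f2])
    (by
      filter_upwards [ae_hasDerivAt_of_eq_integral hyI hye, ae_hasDerivAt_of_eq_integral hD hXe']
        with s h1 h2 hs
      have hsT := hsub (Ioo_subset_Icc_self hs)
      refine ⟨_, ?_, (h1 hs).inner ℝ ((h2 hs).clm_apply (h1 hs))⟩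
      have hsym := fun a b => (hXs s hsT).inner_apply_comm a b
      -- the two halves of the drift of `y` cancel the quadratic term
      have : inner ℝ (y s) ((Q s - X s * V s * X s) (y s) + X s (Y' s)) +
          inner ℝ (Y' s) (X s (y s)) = inner ℝ (y s) (Q s (y s)) := by
        simp only [hY', sub_apply, smul_apply,
          mul_apply_eq_comp, map_smul, inner_add_right, inner_sub_right, inner_smul_right,
          inner_smul_left]
        have e1 := hsym (y s) (V s (X s (y s)))
        have e2 := real_inner_comm (X s (y s)) (V s (X s (y s)))
        simp only [conj_trivial]
        linarith
      rw [this]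
      exact (hQp s hsT).inner_nonneg_right _)
  simp only [hyt, hX0] at key
  exact (hX₀.inner_nonneg_right _).trans key

/-- A nonnegative solution of `X' = Q - X V X` with `V` nonnegative is bounded independently of `V`,
because the quadratic term only makes it smaller. -/
theorem norm_le_of_riccati {T w : ℝ} {X₀ : H →L[ℝ] H} {Q V X : ℝ → H →L[ℝ] H}
    (hQ : IntegrableOn Q (Icc 0 T))
    (hVm : AEStronglyMeasurable V (volume.restrict (Icc 0 T)))
    (hVb : ∀ᵐ τ ∂(volume.restrict (Icc 0 T)), ‖V τ‖ ≤ w)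
    (hVp : ∀ t ∈ Icc 0 T, (V t).IsPositive)
    (hX : ContinuousOn X (Icc 0 T)) (hXp : ∀ t ∈ Icc 0 T, (X t).IsPositive)
    (hXe : ∀ t ∈ Icc 0 T, X t = X₀ + ∫ τ in (0 : ℝ)..t, (Q τ - X τ * V τ * X τ)) :
    ∀ t ∈ Icc 0 T, ‖X t‖ ≤ ‖X₀‖ + ∫ τ in Icc 0 T, ‖Q τ‖ := by
  intro t ht
  have h0 : (0 : ℝ) ∈ Icc 0 T := ⟨le_rfl, ht.1.trans ht.2⟩
  have hD : IntegrableOn (fun τ => Q τ - X τ * V τ * X τ) (Icc 0 T) :=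
    hQ.sub (integrableOn_mul_mul hVm hVb hX hX)
  have hi := intervalIntegrable_of_integrableOn_Icc hD h0 ht
  have hq0 : 0 ≤ ∫ τ in Icc 0 T, ‖Q τ‖ := integral_nonneg fun _ => norm_nonneg _
  refine norm_le_of_inner_le (hXp t ht) (by positivity) fun x => ?_
  let ℓ : (H →L[ℝ] H) →L[ℝ] ℝ := (innerSL ℝ x).comp (ContinuousLinearMap.apply ℝ H x)
  have hℓ : ∀ A, ℓ A = inner ℝ x (A x) := fun A => rfl
  have hval : inner ℝ x (X t x) = inner ℝ x (X₀ x) +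
      ∫ τ in (0 : ℝ)..t, ℓ (Q τ - X τ * V τ * X τ) := by
    rw [ℓ.intervalIntegral_comp_comm hi, ← hℓ, hXe t ht, map_add, ← hℓ]
  have hA : ∀ A : H →L[ℝ] H, inner ℝ x (A x) ≤ ‖A‖ * ‖x‖ ^ 2 := fun A =>
    (real_inner_le_norm _ _).trans (by nlinarith [A.le_opNorm x, norm_nonneg x])
  have hint : ∫ τ in (0 : ℝ)..t, ℓ (Q τ - X τ * V τ * X τ) ≤
      ∫ τ in (0 : ℝ)..t, ‖Q τ‖ * ‖x‖ ^ 2 := by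
    refine intervalIntegral.integral_mono_on ht.1
      (intervalIntegrable_of_integrableOn_Icc (ℓ.integrable_comp hD) h0 ht)
      (intervalIntegrable_of_integrableOn_Icc (hQ.norm.mul_const _) h0 ht) fun τ hτ => ?_
    have hτT : τ ∈ Icc 0 T := ⟨hτ.1, hτ.2.trans ht.2⟩
    have h1 : inner ℝ x (X τ (V τ (X τ x))) = inner ℝ (X τ x) (V τ (X τ x)) :=
      ((hXp τ hτT).isSelfAdjoint.inner_apply_comm _ _).symm
    have h2 := (hVp τ hτT).inner_nonneg_right (X τ x)
    have h3 := hA (Q τ)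
    rw [hℓ, sub_apply, inner_sub_right, mul_apply_eq_comp,
      mul_apply_eq_comp, h1]
    linarith
  have hle : ∫ τ in (0 : ℝ)..t, ‖Q τ‖ ≤ ∫ τ in Icc 0 T, ‖Q τ‖ := by
    rw [intervalIntegral.integral_of_le ht.1]
    refine setIntegral_mono_set hQ.norm (Eventually.of_forall fun _ => norm_nonneg _) ?_
    exact LE.le.eventuallyLE (Ioc_subset_Icc_self.trans (Icc_subset_Icc_right ht.2))
  rw [hval]
  rw [intervalIntegral.integral_mul_const] at hint
  have := mul_le_mul_of_nonneg_right hle (sq_nonneg ‖x‖)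
  have := hA X₀
  rw [add_mul]
  linarith

/-- The solution of `X' = Q - X W X` is found as the solution of the equation with radially
truncated quadratic term, for a truncation radius that the solution cannot reach. -/
theorem exists_solvesRiccati {T w : ℝ} (hT : 0 ≤ T) {X₀ : H →L[ℝ] H} {Q W : ℝ → H →L[ℝ] H}
    (hX₀ : X₀.IsPositive) (hQ : IntegrableOn Q (Icc 0 T))
    (hQp : ∀ t ∈ Icc 0 T, (Q t).IsPositive)
    (hWm : AEStronglyMeasurable W (volume.restrict (Icc 0 T)))
    (hWb : ∀ᵐ τ ∂(volume.restrict (Icc 0 T)), ‖W τ‖ ≤ w)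
    (hWp : ∀ t ∈ Icc 0 T, (W t).IsPositive) :
    ∃ X, SolvesRiccati T X₀ Q W X ∧ (∀ t ∈ Icc 0 T, (X t).IsPositive) ∧
      ∀ t ∈ Icc 0 T, ‖X t‖ ≤ ‖X₀‖ + ∫ τ in Icc 0 T, ‖Q τ‖ := by
  -- one more than the a priori bound, so that the radius is positive
  set K : ℝ := ‖X₀‖ + (∫ τ in Icc 0 T, ‖Q τ‖) + 1 with hK
  have hq0 : 0 ≤ ∫ τ in Icc 0 T, ‖Q τ‖ := integral_nonneg fun _ => norm_nonneg _
  have hK0 : 0 < K := by positivity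
  set F : ℝ → (H →L[ℝ] H) → (H →L[ℝ] H) :=
    fun τ A => Q τ - radialCut K A * W τ * radialCut K A with hF
  have hrc : ∀ x : ℝ → H →L[ℝ] H, ContinuousOn x (Icc 0 T) →
      ContinuousOn (fun τ => radialCut K (x τ)) (Icc 0 T) := fun x hx =>
    (continuous_radialCut hK0).comp_continuousOn hx
  have hint : ∀ x : ℝ → H →L[ℝ] H, ContinuousOn x (Icc 0 T) →
      IntegrableOn (fun τ => F τ (x τ)) (Icc 0 T) := fun x hx =>
    hQ.sub (integrableOn_mul_mul hWm hWb (hrc x hx) (hrc x hx))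
  have hlip : ∀ᵐ τ ∂(volume.restrict (Icc 0 T)), ∀ x y,
      ‖F τ x - F τ y‖ ≤ 4 * K * max w 0 * ‖x - y‖ := by
    filter_upwards [hWb] with τ hτ x y
    have hw : ‖W τ‖ ≤ max w 0 := hτ.trans (le_max_left _ _)
    have e : F τ x - F τ y = -((radialCut K x - radialCut K y) * W τ * radialCut K x +
        radialCut K y * W τ * (radialCut K x - radialCut K y)) := by
      simp only [hF]
      noncomm_ring
    have h1 := norm_radialCut_sub_le hK0 x y
    have h2 := norm_radialCut_le hK0 x
    have h3 := norm_radialCut_le hK0 y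
    rw [e, norm_neg]
    have a1 : ‖(radialCut K x - radialCut K y) * W τ * radialCut K x‖ ≤
        (2 * ‖x - y‖) * max w 0 * K := norm_mul₃_le.trans (by gcongr)
    have a2 : ‖radialCut K y * W τ * (radialCut K x - radialCut K y)‖ ≤
        K * max w 0 * (2 * ‖x - y‖) := norm_mul₃_le.trans (by gcongr)
    refine (norm_add_le _ _).trans ?_
    linarith
  have hL : 0 ≤ 4 * K * max w 0 := by positivity
  obtain ⟨X, hXc, hXe⟩ := exists_volterra_solution hT hL hint hlip X₀
  have h0 : (0 : ℝ) ∈ Icc 0 T := ⟨le_rfl, hT⟩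
  -- the adjoint of a solution of the truncated equation solves it as well
  have hstar : EqOn (fun t => star (X t)) X (Icc 0 T) := by
    refine volterra_unique hL hint hlip (x₀ := X₀) (continuous_star.comp_continuousOn hXc) hXc
      (fun t ht => ?_) hXe
    have hcomm := ((starL' ℝ : (H →L[ℝ] H) ≃L[ℝ] (H →L[ℝ] H)) :
      (H →L[ℝ] H) →L[ℝ] (H →L[ℝ] H)).intervalIntegral_comp_comm
      (intervalIntegrable_of_integrableOn_Icc (hint X hXc) h0 ht)
    simp only [ContinuousLinearEquiv.coe_coe, starL'_apply] at hcomm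
    rw [hXe t ht, star_add, hX₀.isSelfAdjoint.star_eq, ← hcomm]
    congr 1
    refine intervalIntegral.integral_congr fun τ hτ => ?_
    rw [uIcc_of_le ht.1] at hτ
    have hτT : τ ∈ Icc 0 T := ⟨hτ.1, hτ.2.trans ht.2⟩
    have hr : star (radialCut K (X τ)) = radialCut K (star (X τ)) := by
      have hn : ‖star (X τ)‖ = ‖X τ‖ := ContinuousLinearMap.adjoint.norm_map (X τ)
      rw [radialCut, radialCut, star_smul, hn, star_trivial]
    simp only [hF, star_sub, star_mul, (hQp τ hτT).isSelfAdjoint.star_eq,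
      (hWp τ hτT).isSelfAdjoint.star_eq, hr, mul_assoc]
  have hXs : ∀ t ∈ Icc 0 T, IsSelfAdjoint (X t) := fun t ht => hstar ht
  -- absorb the truncation into the quadratic coefficient
  set V : ℝ → H →L[ℝ] H := fun τ => (K / max K ‖X τ‖) ^ 2 • W τ with hV
  have hFV : ∀ τ, F τ (X τ) = Q τ - X τ * V τ * X τ := fun τ => by
    simp only [hF, hV, radialCut, smul_mul_assoc, mul_smul_comm, smul_smul, sq]
  have hVm : AEStronglyMeasurable V (volume.restrict (Icc 0 T)) := by
    refine AEStronglyMeasurable.fun_smul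
      (ContinuousOn.aestronglyMeasurable ?_ measurableSet_Icc) hWm
    refine ContinuousOn.pow
      (continuousOn_const.div (continuousOn_const.sup hXc.norm) fun τ _ => ?_) 2
    exact (lt_max_of_lt_left hK0).ne'
  have hc0 : ∀ τ, 0 ≤ K / max K ‖X τ‖ := fun τ => radialCut_coeff_nonneg hK0 _
  have hVb : ∀ᵐ τ ∂(volume.restrict (Icc 0 T)), ‖V τ‖ ≤ w := by
    filter_upwards [hWb] with τ hτ
    rw [hV, norm_smul, Real.norm_of_nonneg (by positivity)]
    exact (mul_le_of_le_one_left (norm_nonneg _)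
      (pow_le_one₀ (hc0 τ) (radialCut_coeff_le_one hK0 _))).trans hτ
  have hVp : ∀ t ∈ Icc 0 T, (V t).IsPositive := fun t ht =>
    (hWp t ht).smul_of_nonneg (by positivity)
  simp only [hFV] at hXe
  have hXp := isPositive_of_riccati hX₀ hQ hQp hVm hVb hXc hXs hXe
  have hXb := norm_le_of_riccati hQ hVm hVb hVp hXc hXp hXe
  -- the bound on `X` makes the truncation, and hence the factor in `V`, trivial
  refine ⟨X, ⟨hXc, fun t ht => ?_⟩, hXp, hXb⟩
  rw [hXe t ht]
  congr 1
  refine intervalIntegral.integral_congr fun τ hτ => ?_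
  rw [uIcc_of_le ht.1] at hτ
  have hτT : τ ∈ Icc 0 T := ⟨hτ.1, hτ.2.trans ht.2⟩
  have : ‖X τ‖ ≤ K := (hXb τ hτT).trans (by rw [hK]; linarith)
  simp only [hV, max_eq_left this, div_self hK0.ne', one_pow, one_smul]

end Riccati

/-! ### Removing the semigroup from the mild Riccati equation -/

section MildRiccati

variable {H : Type*} [NormedAddCommGroup H] [InnerProductSpace ℝ H]

theorem integrableOn_conj {T : ℝ} {A B G : ℝ → H →L[ℝ] H} (hA : ContinuousOn A (Icc 0 T))
    (hB : ContinuousOn B (Icc 0 T)) (hG : IntegrableOn G (Icc 0 T)) :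
    IntegrableOn (fun τ => A τ * G τ * B τ) (Icc 0 T) :=
  (hG.continuousOn_mul hA isCompact_Icc).mul_continuousOn hB isCompact_Icc

theorem proj_mul_sub_mul_proj {p A B C : H →L[ℝ] H} (hA : p * A * p = A)
    (hB : p * B = B) (hB' : B * p = B) : p * (A - B * C * B) * p = A - B * C * B := by
  rw [mul_sub, sub_mul, hA, ← mul_assoc, ← mul_assoc, hB, mul_assoc (B * C), hB']

variable [CompleteSpace H]

/-- A norm-continuous operator semigroup on `[0,∞)` whose value `S 0` at time zero, necessarily
idempotent, is self-adjoint, hence the orthogonal projection onto a closed subspace. -/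
structure IsProjectedSemigroup (S : ℝ → H →L[ℝ] H) : Prop where
  add : ∀ s t : ℝ, 0 ≤ s → 0 ≤ t → S (s + t) = S s * S t
  continuousOn : ContinuousOn S (Ici 0)
  isSelfAdjoint : IsSelfAdjoint (S 0)

/-- The extension of a semigroup on the range of the projection `S 0` to the whole space by the
identity on the orthogonal complement. -/
def extendedSemigroup (S : ℝ → H →L[ℝ] H) (t : ℝ) : H →L[ℝ] H := S t + (1 - S 0)

/-- The inverses of the operators of the extended semigroup. -/
def extendedSemigroupInv (S : ℝ → H →L[ℝ] H) (t : ℝ) : H →L[ℝ] H :=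
  Ring.inverse (extendedSemigroup S t)

namespace IsProjectedSemigroup

variable {S : ℝ → H →L[ℝ] H}

theorem mul_zero (hS : IsProjectedSemigroup S) {t : ℝ} (ht : 0 ≤ t) : S t * S 0 = S t := by
  rw [← hS.add t 0 ht le_rfl, add_zero]

theorem zero_mul (hS : IsProjectedSemigroup S) {t : ℝ} (ht : 0 ≤ t) : S 0 * S t = S t := by
  rw [← hS.add 0 t le_rfl ht, zero_add]

theorem extended_mul_zero (hS : IsProjectedSemigroup S) {t : ℝ} (ht : 0 ≤ t) :
    extendedSemigroup S t * S 0 = S t := by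
  rw [extendedSemigroup, add_mul, sub_mul, hS.mul_zero ht, hS.mul_zero le_rfl, one_mul, sub_self,
    add_zero]

theorem zero_mul_extended (hS : IsProjectedSemigroup S) {t : ℝ} (ht : 0 ≤ t) :
    S 0 * extendedSemigroup S t = S t := by
  rw [extendedSemigroup, mul_add, mul_sub, hS.zero_mul ht, hS.mul_zero le_rfl, mul_one, sub_self,
    add_zero]

theorem extended_add (hS : IsProjectedSemigroup S) {s t : ℝ} (hs : 0 ≤ s) (ht : 0 ≤ t) :
    extendedSemigroup S (s + t) = extendedSemigroup S s * extendedSemigroup S t := by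
  have h1 := hS.mul_zero hs
  have h2 := hS.zero_mul ht
  have h3 := hS.mul_zero le_rfl
  simp only [extendedSemigroup, hS.add s t hs ht, mul_add, add_mul, mul_sub, sub_mul, h1, h2, h3,
    mul_one, one_mul]
  abel

theorem extended_continuousOn (hS : IsProjectedSemigroup S) :
    ContinuousOn (extendedSemigroup S) (Ici 0) :=
  hS.continuousOn.add continuousOn_const

/-- The operators of the extended semigroup are invertible: near time zero they are close to the
identity, and the others are powers of these. -/
theorem isUnit_extended (hS : IsProjectedSemigroup S) {t : ℝ} (ht : 0 ≤ t) :
    IsUnit (extendedSemigroup S t) := by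
  have h0 : extendedSemigroup S 0 = 1 := by simp [extendedSemigroup]
  have hev : ∀ᶠ s in 𝓝[≥] (0 : ℝ), IsUnit (extendedSemigroup S s) := by
    have := (hS.extended_continuousOn 0 self_mem_Ici).tendsto
    rw [h0] at this
    exact this.eventually (Units.isOpen.mem_nhds isUnit_one)
  obtain ⟨δ, hδ, hδu⟩ := mem_nhdsGE_iff_exists_Ico_subset.1 hev
  have hδ0 : (0 : ℝ) < δ := hδ
  obtain ⟨k, hk⟩ := exists_nat_gt (t / δ)
  have hpow : ∀ (j : ℕ) (s : ℝ), 0 ≤ s →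
      extendedSemigroup S (j * s) = extendedSemigroup S s ^ j := by
    intro j s hs
    induction j with
    | zero => simp [h0]
    | succ j ih =>
      rw [pow_succ, ← ih, ← hS.extended_add (by positivity) hs]
      congr 1
      push_cast
      ring
  have hk0 : (0 : ℝ) < k := lt_of_le_of_lt (by positivity) hk
  have hs0 : 0 ≤ t / k := by positivity
  have hu : IsUnit (extendedSemigroup S (t / k)) := by
    refine hδu ⟨hs0, ?_⟩
    rw [div_lt_iff₀ hδ0] at hk
    rw [div_lt_iff₀ hk0]
    linarith
  have := hpow k _ hs0
  rw [mul_div_cancel₀ _ hk0.ne'] at this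
  rw [this]
  exact hu.pow k

theorem extended_mul_inv (hS : IsProjectedSemigroup S) {t : ℝ} (ht : 0 ≤ t) :
    extendedSemigroup S t * extendedSemigroupInv S t = 1 :=
  Ring.mul_inverse_cancel _ (hS.isUnit_extended ht)

theorem inv_mul_extended (hS : IsProjectedSemigroup S) {t : ℝ} (ht : 0 ≤ t) :
    extendedSemigroupInv S t * extendedSemigroup S t = 1 :=
  Ring.inverse_mul_cancel _ (hS.isUnit_extended ht)

theorem inv_continuousOn (hS : IsProjectedSemigroup S) :
    ContinuousOn (extendedSemigroupInv S) (Ici 0) := by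
  intro t ht
  obtain ⟨u, hu⟩ := hS.isUnit_extended ht
  have h := NormedRing.inverse_continuousAt u
  rw [hu] at h
  exact h.comp_continuousWithinAt (hS.extended_continuousOn t ht)

theorem zero_mul_inv (hS : IsProjectedSemigroup S) {t : ℝ} (ht : 0 ≤ t) :
    S 0 * extendedSemigroupInv S t = extendedSemigroupInv S t * S 0 := by
  have h1 := hS.extended_mul_inv ht
  have h2 := hS.inv_mul_extended ht
  have h3 : extendedSemigroup S t * S 0 = S 0 * extendedSemigroup S t := by
    rw [hS.extended_mul_zero ht, hS.zero_mul_extended ht]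
  calc S 0 * extendedSemigroupInv S t
      = extendedSemigroupInv S t * (extendedSemigroup S t * S 0) * extendedSemigroupInv S t := by
        rw [← mul_assoc, h2, one_mul]
    _ = extendedSemigroupInv S t * S 0 * (extendedSemigroup S t * extendedSemigroupInv S t) := by
        rw [h3]; simp only [mul_assoc]
    _ = _ := by rw [h1, mul_one]

theorem extended_sub (hS : IsProjectedSemigroup S) {s t : ℝ} (hs : 0 ≤ s) (hst : s ≤ t) :
    extendedSemigroup S (t - s) = extendedSemigroup S t * extendedSemigroupInv S s := by
  have := hS.extended_add (sub_nonneg.2 hst) hs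
  rw [sub_add_cancel] at this
  rw [this, mul_assoc, hS.extended_mul_inv hs, mul_one]

/-- On operators on the range of `S 0`, conjugation by `S (t - s)` is conjugation by the inverse of
the extended `S s` followed by conjugation by the extended `S t`. -/
theorem conj_sub (hS : IsProjectedSemigroup S) {s t : ℝ} (hs : 0 ≤ s) (hst : s ≤ t) {G : H →L[ℝ] H}
    (hG : S 0 * G * S 0 = G) :
    S (t - s) * G * star (S (t - s)) = extendedSemigroup S t *
      (extendedSemigroupInv S s * G * star (extendedSemigroupInv S s)) *
        star (extendedSemigroup S t) := by
  rw [← hS.extended_mul_zero (sub_nonneg.2 hst), star_mul, hS.isSelfAdjoint.star_eq]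
  calc extendedSemigroup S (t - s) * S 0 * G * (S 0 * star (extendedSemigroup S (t - s)))
      = extendedSemigroup S (t - s) * (S 0 * G * S 0) * star (extendedSemigroup S (t - s)) := by
        simp only [mul_assoc]
    _ = _ := by
        rw [hG, hS.extended_sub hs hst, star_mul]
        simp only [mul_assoc]

end IsProjectedSemigroup

theorem intervalIntegral_mul_mul {t : ℝ} (A B : H →L[ℝ] H) {G : ℝ → H →L[ℝ] H}
    (hG : IntervalIntegrable G volume 0 t) :
    ∫ τ in (0 : ℝ)..t, A * G τ * B = A * (∫ τ in (0 : ℝ)..t, G τ) * B := by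
  have h1 := ((ContinuousLinearMap.mul ℝ (H →L[ℝ] H)) A).intervalIntegral_comp_comm hG
  have hi : IntervalIntegrable (fun τ => A * G τ) volume 0 t :=
    hG.continuousOn_mul continuousOn_const
  have h2 := ((ContinuousLinearMap.mul ℝ (H →L[ℝ] H)).flip B).intervalIntegral_comp_comm hi
  simp only [ContinuousLinearMap.mul_apply', ContinuousLinearMap.flip_apply] at h1 h2
  rw [h2, h1]

/-- The driving term `Σ⁻¹ Q Σ⁻⋆` of the Riccati equation in the coordinates that remove the semigroup,
with `Σ` the extended semigroup. -/
def pulledBackSource (S Q : ℝ → H →L[ℝ] H) (t : ℝ) : H →L[ℝ] H :=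
  extendedSemigroupInv S t * Q t * star (extendedSemigroupInv S t)

/-- The quadratic coefficient `Σ⋆ W Σ` of the Riccati equation in the coordinates that remove the
semigroup, with `Σ` the extended semigroup. -/
def pulledBackCoeff (S W : ℝ → H →L[ℝ] H) (t : ℝ) : H →L[ℝ] H :=
  star (extendedSemigroup S t) * W t * extendedSemigroup S t

/-- The unknown `Σ⁻¹ Π Σ⁻⋆` of the Riccati equation in the coordinates that remove the semigroup,
with `Σ` the extended semigroup. -/
def pulledBackCov (S Pi : ℝ → H →L[ℝ] H) (t : ℝ) : H →L[ℝ] H :=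
  extendedSemigroupInv S t * Pi t * star (extendedSemigroupInv S t)

variable {S : ℝ → H →L[ℝ] H} {T w : ℝ} {Pi0 : H →L[ℝ] H} {Q W Pi : ℝ → H →L[ℝ] H}

theorem IsProjectedSemigroup.extended_continuousOn_Icc (hS : IsProjectedSemigroup S) :
    ContinuousOn (extendedSemigroup S) (Icc 0 T) :=
  hS.extended_continuousOn.mono fun _ ht => ht.1

theorem IsProjectedSemigroup.inv_continuousOn_Icc (hS : IsProjectedSemigroup S) :
    ContinuousOn (extendedSemigroupInv S) (Icc 0 T) :=
  hS.inv_continuousOn.mono fun _ ht => ht.1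

theorem pulledBackSource_integrableOn (hS : IsProjectedSemigroup S)
    (hQ : IntegrableOn Q (Icc 0 T)) :
    IntegrableOn (pulledBackSource S Q) (Icc 0 T) :=
  integrableOn_conj hS.inv_continuousOn_Icc
    (continuous_star.comp_continuousOn hS.inv_continuousOn_Icc) hQ

theorem ContinuousLinearMap.IsPositive.mul_star_conj {A : H →L[ℝ] H} (hA : A.IsPositive)
    (B : H →L[ℝ] H) :
    (B * A * star B).IsPositive :=
  hA.conj_adjoint B

theorem ContinuousLinearMap.IsPositive.star_mul_conj {A : H →L[ℝ] H} (hA : A.IsPositive)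
    (B : H →L[ℝ] H) :
    (star B * A * B).IsPositive :=
  hA.adjoint_conj B

theorem pulledBackCoeff_aestronglyMeasurable (hS : IsProjectedSemigroup S)
    (hW : AEStronglyMeasurable W (volume.restrict (Icc 0 T))) :
    AEStronglyMeasurable (pulledBackCoeff S W) (volume.restrict (Icc 0 T)) :=
  (((continuous_star.comp_continuousOn hS.extended_continuousOn_Icc).aestronglyMeasurable
    measurableSet_Icc).mul hW).mul (hS.extended_continuousOn_Icc.aestronglyMeasurable
    measurableSet_Icc)

theorem norm_star_eq (A : H →L[ℝ] H) : ‖star A‖ = ‖A‖ := ContinuousLinearMap.adjoint.norm_map A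

theorem pulledBackCoeff_bound (hS : IsProjectedSemigroup S) (T w : ℝ) :
    ∃ w', ∀ W : ℝ → H →L[ℝ] H, (∀ᵐ τ ∂(volume.restrict (Icc 0 T)), ‖W τ‖ ≤ w) →
      ∀ᵐ τ ∂(volume.restrict (Icc 0 T)), ‖pulledBackCoeff S W τ‖ ≤ w' := by
  obtain ⟨c, hc⟩ := isCompact_Icc.exists_bound_of_continuousOn
    (hS.extended_continuousOn_Icc (T := T))
  refine ⟨c * w * c, fun W hW => ?_⟩
  filter_upwards [hW, ae_restrict_mem measurableSet_Icc] with τ hτ hm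
  have h1 := hc τ hm
  have hc0 := (norm_nonneg _).trans h1
  have hw0 := (norm_nonneg _).trans hτ
  refine norm_mul₃_le.trans ?_
  rw [norm_star_eq]
  gcongr

/-- The inverse conjugation takes the right-hand side of the Riccati equation to a right-hand side
of the same form, with transformed data. -/
theorem pulledBack_riccati_rhs (hS : IsProjectedSemigroup S) {τ : ℝ} (hτ : 0 ≤ τ) :
    extendedSemigroupInv S τ * (Q τ - Pi τ * W τ * Pi τ) * star (extendedSemigroupInv S τ) =
      pulledBackSource S Q τ -
        pulledBackCov S Pi τ * pulledBackCoeff S W τ * pulledBackCov S Pi τ := by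
  have h1 := hS.extended_mul_inv hτ
  have h2 : star (extendedSemigroupInv S τ) * star (extendedSemigroup S τ) = 1 := by
    rw [← star_mul, h1, star_one]
  have h3 : pulledBackCov S Pi τ * pulledBackCoeff S W τ * pulledBackCov S Pi τ =
      extendedSemigroupInv S τ * (Pi τ * W τ * Pi τ) * star (extendedSemigroupInv S τ) := by
    simp only [pulledBackCov, pulledBackCoeff]
    calc _ = extendedSemigroupInv S τ * Pi τ *
          (star (extendedSemigroupInv S τ) * star (extendedSemigroup S τ)) * W τ *
          (extendedSemigroup S τ * extendedSemigroupInv S τ) * Pi τ *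
            star (extendedSemigroupInv S τ) := by simp only [mul_assoc]
      _ = _ := by rw [h1, h2]; simp only [mul_assoc, mul_one]
  rw [h3, pulledBackSource, mul_sub, sub_mul]

/-- A mild solution takes its values in the operators on the range of the projection `S 0`. -/
theorem IsRiccatiMildSolution.proj_mul (hS : IsProjectedSemigroup S)
    (hQ : IntegrableOn Q (Icc 0 T))
    (hWm : AEStronglyMeasurable W (volume.restrict (Icc 0 T)))
    (hWb : ∀ᵐ τ ∂(volume.restrict (Icc 0 T)), ‖W τ‖ ≤ w)
    (hPi : IsRiccatiMildSolution T S Pi0 Q W Pi) {t : ℝ} (ht : t ∈ Icc 0 T) :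
    S 0 * Pi t = Pi t ∧ Pi t * S 0 = Pi t := by
  have hG : IntegrableOn (fun τ => Q τ - Pi τ * W τ * Pi τ) (Icc 0 t) :=
    (hQ.sub (integrableOn_mul_mul hWm hWb hPi.1 hPi.1)).mono_set (Icc_subset_Icc_right ht.2)
  have hSc : ContinuousOn (fun τ => S (t - τ)) (Icc 0 t) :=
    hS.continuousOn.comp (by fun_prop) fun τ hτ => sub_nonneg.2 hτ.2
  have hI : IntervalIntegrable (fun τ => S (t - τ) * (Q τ - Pi τ * W τ * Pi τ) * star (S (t - τ)))
      volume 0 t := intervalIntegrable_of_integrableOn_Icc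
        (integrableOn_conj hSc (continuous_star.comp_continuousOn hSc) hG)
          ⟨le_rfl, ht.1⟩ ⟨ht.1, le_rfl⟩
  have he : Pi t = S t * Pi0 * star (S t) + ∫ τ in (0 : ℝ)..t,
      S (t - τ) * (Q τ - Pi τ * W τ * Pi τ) * star (S (t - τ)) := hPi.2 t ht
  have hstar : ∀ {s : ℝ}, 0 ≤ s → star (S s) * S 0 = star (S s) := fun {s} hs => by
    conv_lhs => rw [← hS.isSelfAdjoint.star_eq, ← star_mul, hS.zero_mul hs]
  have hl := intervalIntegral_mul_mul (S 0) 1 hI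
  have hr := intervalIntegral_mul_mul 1 (S 0) hI
  simp only [mul_one, one_mul] at hl hr
  constructor
  · rw [he, mul_add, ← hl, ← mul_assoc, ← mul_assoc, hS.zero_mul ht.1]
    congr 1
    refine intervalIntegral.integral_congr fun τ hτ => ?_
    rw [uIcc_of_le ht.1] at hτ
    simp only [← mul_assoc, hS.zero_mul (sub_nonneg.2 hτ.2)]
  · rw [he, add_mul, ← hr, mul_assoc, hstar ht.1]
    congr 1
    refine intervalIntegral.integral_congr fun τ hτ => ?_
    rw [uIcc_of_le ht.1] at hτ
    simp only [mul_assoc, hstar (sub_nonneg.2 hτ.2)]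

/-- In the coordinates that remove the semigroup, a mild solution solves the Riccati equation
without drift. -/
theorem IsRiccatiMildSolution.solvesRiccati (hS : IsProjectedSemigroup S)
    (hPi0 : S 0 * Pi0 * S 0 = Pi0) (hQp : ∀ τ, S 0 * Q τ * S 0 = Q τ)
    (hQ : IntegrableOn Q (Icc 0 T))
    (hWm : AEStronglyMeasurable W (volume.restrict (Icc 0 T)))
    (hWb : ∀ᵐ τ ∂(volume.restrict (Icc 0 T)), ‖W τ‖ ≤ w)
    (hPi : IsRiccatiMildSolution T S Pi0 Q W Pi) :
    SolvesRiccati T Pi0 (pulledBackSource S Q) (pulledBackCoeff S W) (pulledBackCov S Pi) := by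
  have hXc : ContinuousOn (pulledBackCov S Pi) (Icc 0 T) :=
    (hS.inv_continuousOn_Icc.mul hPi.1).mul
      (continuous_star.comp_continuousOn hS.inv_continuousOn_Icc)
  refine ⟨hXc, fun t ht => ?_⟩
  obtain ⟨w', hw'⟩ := pulledBackCoeff_bound hS T w
  have hD : IntegrableOn (fun τ => pulledBackSource S Q τ -
      pulledBackCov S Pi τ * pulledBackCoeff S W τ * pulledBackCov S Pi τ) (Icc 0 T) :=
    (pulledBackSource_integrableOn hS hQ).sub (integrableOn_mul_mul
      (pulledBackCoeff_aestronglyMeasurable hS hWm) (hw' W hWb) hXc hXc)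
  have h0T : (0 : ℝ) ∈ Icc 0 T := ⟨le_rfl, ht.1.trans ht.2⟩
  have he : Pi t = S t * Pi0 * star (S t) + ∫ τ in (0 : ℝ)..t,
      S (t - τ) * (Q τ - Pi τ * W τ * Pi τ) * star (S (t - τ)) := hPi.2 t ht
  have hcongr : ∫ τ in (0 : ℝ)..t, S (t - τ) * (Q τ - Pi τ * W τ * Pi τ) * star (S (t - τ)) =
      ∫ τ in (0 : ℝ)..t, extendedSemigroup S t * (pulledBackSource S Q τ -
        pulledBackCov S Pi τ * pulledBackCoeff S W τ * pulledBackCov S Pi τ) *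
          star (extendedSemigroup S t) := by
    refine intervalIntegral.integral_congr fun τ hτ => ?_
    rw [uIcc_of_le ht.1] at hτ
    obtain ⟨hl, hr⟩ := hPi.proj_mul hS hQ hWm hWb ⟨hτ.1, hτ.2.trans ht.2⟩
    rw [hS.conj_sub hτ.1 hτ.2 (proj_mul_sub_mul_proj (hQp τ) hl hr), pulledBack_riccati_rhs hS hτ.1]
  have h1 : S t * Pi0 * star (S t) =
      extendedSemigroup S t * Pi0 * star (extendedSemigroup S t) := by
    have h2 := hS.conj_sub le_rfl ht.1 hPi0
    have h3 : extendedSemigroupInv S 0 = 1 := by simp [extendedSemigroupInv, extendedSemigroup]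
    simpa only [sub_zero, h3, star_one, one_mul, mul_one] using h2
  rw [hcongr, intervalIntegral_mul_mul _ _ (intervalIntegrable_of_integrableOn_Icc hD h0T ht), h1,
    ← add_mul, ← mul_add] at he
  have h2 : star (extendedSemigroup S t) * star (extendedSemigroupInv S t) = 1 := by
    rw [← star_mul, hS.inv_mul_extended ht.1, star_one]
  rw [pulledBackCov, he]
  simp only [mul_assoc, h2, mul_one]
  rw [← mul_assoc, hS.inv_mul_extended ht.1, one_mul]

/-- A solution `X` of the Riccati equation without drift yields the mild solution `S X S⋆`. Here the
coefficient is compressed to the range of `S 0`: since `S = S (S 0)`, only the compression of `X`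
enters `S X S⋆`, and it is this compression that solves the equation with the original
coefficient. -/
theorem SolvesRiccati.isRiccatiMildSolution (hS : IsProjectedSemigroup S)
    (hQp : ∀ τ, S 0 * Q τ * S 0 = Q τ)
    (hQ : IntegrableOn Q (Icc 0 T))
    (hWm : AEStronglyMeasurable W (volume.restrict (Icc 0 T)))
    (hWb : ∀ᵐ τ ∂(volume.restrict (Icc 0 T)), ‖W τ‖ ≤ w) {X : ℝ → H →L[ℝ] H}
    (hX : SolvesRiccati T Pi0 (pulledBackSource S Q)
      (fun t => S 0 * pulledBackCoeff S W t * S 0) X) :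
    IsRiccatiMildSolution T S Pi0 Q W (fun t => S t * X t * star (S t)) := by
  have hSc : ContinuousOn S (Icc 0 T) := hS.continuousOn.mono fun _ ht => ht.1
  refine ⟨(hSc.mul hX.1).mul (continuous_star.comp_continuousOn hSc), fun t ht => ?_⟩
  set Y : ℝ → H →L[ℝ] H := fun t => S t * X t * star (S t) with hY
  have h0T : (0 : ℝ) ∈ Icc 0 T := ⟨le_rfl, ht.1.trans ht.2⟩
  have hpp : S 0 * S 0 = S 0 := hS.mul_zero le_rfl
  have hps : star (S 0) = S 0 := hS.isSelfAdjoint.star_eq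
  have hinv : ∀ {s : ℝ}, 0 ≤ s → S s * S 0 = S s := fun hs => hS.mul_zero hs
  -- the pulled back solution is the compression of `X`
  have hYX : ∀ τ, 0 ≤ τ → pulledBackCov S Y τ = S 0 * X τ * S 0 := by
    intro τ hτ
    have h1 : extendedSemigroupInv S τ * S τ = S 0 := by
      rw [← hS.extended_mul_zero hτ, ← mul_assoc, hS.inv_mul_extended hτ, one_mul]
    have h2 : star (S τ) * star (extendedSemigroupInv S τ) = S 0 := by
      rw [← star_mul, h1, hps]
    calc pulledBackCov S Y τ = (extendedSemigroupInv S τ * S τ) * X τ *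
          (star (S τ) * star (extendedSemigroupInv S τ)) := by
          simp only [pulledBackCov, hY, mul_assoc]
      _ = _ := by rw [h1, h2]
  have hQs : ∀ τ, 0 ≤ τ → S 0 * pulledBackSource S Q τ * S 0 = pulledBackSource S Q τ := by
    intro τ hτ
    have h1 := hS.zero_mul_inv hτ
    have h2 : star (extendedSemigroupInv S τ) * S 0 = S 0 * star (extendedSemigroupInv S τ) := by
      have := congrArg star h1
      rwa [star_mul, star_mul, hps] at this
    calc S 0 * pulledBackSource S Q τ * S 0 = (S 0 * extendedSemigroupInv S τ) * Q τ *
          (star (extendedSemigroupInv S τ) * S 0) := by simp only [pulledBackSource, mul_assoc]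
      _ = extendedSemigroupInv S τ * (S 0 * Q τ * S 0) * star (extendedSemigroupInv S τ) := by
        rw [h1, h2]; simp only [mul_assoc]
      _ = _ := by rw [hQp, pulledBackSource]
  have hsol : ∀ τ ∈ Icc 0 T, S 0 * Y τ = Y τ ∧ Y τ * S 0 = Y τ := by
    intro τ hτ
    have h1 : star (S τ) * S 0 = star (S τ) := by
      conv_lhs => rw [← hps, ← star_mul, hS.zero_mul hτ.1]
    simp only [hY, ← mul_assoc, hS.zero_mul hτ.1, true_and]
    rw [mul_assoc, h1]
  obtain ⟨w', hw'⟩ := pulledBackCoeff_bound hS T w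
  have hI : IntervalIntegrable (fun τ => pulledBackSource S Q τ -
      X τ * (S 0 * pulledBackCoeff S W τ * S 0) * X τ) volume 0 t := by
    refine intervalIntegrable_of_integrableOn_Icc
      ((pulledBackSource_integrableOn hS hQ).sub (integrableOn_mul_mul (w := ‖S 0‖ * w' * ‖S 0‖)
      (W := fun τ => S 0 * pulledBackCoeff S W τ * S 0) ?_ ?_ hX.1 hX.1)) h0T ht
    · exact (pulledBackCoeff_aestronglyMeasurable hS hWm).const_mul _ |>.mul_const _
    · filter_upwards [hw' W hWb] with τ hτ
      exact norm_mul₃_le.trans (by gcongr)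
  have hmain : Y t = S t * Pi0 * star (S t) + S t * (∫ τ in (0 : ℝ)..t, (pulledBackSource S Q τ -
      X τ * (S 0 * pulledBackCoeff S W τ * S 0) * X τ)) * star (S t) := by
    simp only [hY]
    rw [hX.2 t ht, mul_add, add_mul]
  rw [hmain]
  change _ = S t * Pi0 * star (S t) + ∫ τ in (0 : ℝ)..t,
      S (t - τ) * (Q τ - Y τ * W τ * Y τ) * star (S (t - τ))
  congr 1
  rw [← intervalIntegral_mul_mul _ _ hI]
  refine intervalIntegral.integral_congr fun τ hτ => ?_
  rw [uIcc_of_le ht.1] at hτ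
  obtain ⟨hl, hr⟩ := hsol τ ⟨hτ.1, hτ.2.trans ht.2⟩
  rw [hS.conj_sub hτ.1 hτ.2 (proj_mul_sub_mul_proj (hQp τ) hl hr), pulledBack_riccati_rhs hS hτ.1,
    hYX τ hτ.1, ← hS.extended_mul_zero ht.1, star_mul, hps]
  have : S 0 * (pulledBackSource S Q τ - X τ * (S 0 * pulledBackCoeff S W τ * S 0) * X τ) * S 0 =
      pulledBackSource S Q τ - S 0 * X τ * S 0 * pulledBackCoeff S W τ * (S 0 * X τ * S 0) := by
    rw [mul_sub, sub_mul, hQs τ hτ.1]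
    simp only [mul_assoc]
  rw [← this]
  simp only [mul_assoc]

theorem exists_riccatiMildSolution (hT : 0 ≤ T) (hS : IsProjectedSemigroup S)
    (hPi0p : Pi0.IsPositive) (hQ0 : ∀ τ, S 0 * Q τ * S 0 = Q τ)
    (hQp : ∀ t ∈ Icc 0 T, (Q t).IsPositive) (hQ : IntegrableOn Q (Icc 0 T))
    (hWm : AEStronglyMeasurable W (volume.restrict (Icc 0 T)))
    (hWb : ∀ᵐ τ ∂(volume.restrict (Icc 0 T)), ‖W τ‖ ≤ w)
    (hWp : ∀ t ∈ Icc 0 T, (W t).IsPositive) :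
    ∃ Pi, IsRiccatiMildSolution T S Pi0 Q W Pi ∧ ∀ t ∈ Icc 0 T, (Pi t).IsPositive := by
  obtain ⟨w', hw'⟩ := pulledBackCoeff_bound hS T w
  obtain ⟨X, hX, hXp, -⟩ := exists_solvesRiccati hT (w := ‖S 0‖ * w' * ‖S 0‖)
    (W := fun t => S 0 * pulledBackCoeff S W t * S 0) hPi0p
    (pulledBackSource_integrableOn hS hQ) (fun t ht => (hQp t ht).mul_star_conj _)
    ((pulledBackCoeff_aestronglyMeasurable hS hWm).const_mul _ |>.mul_const _)
    (by
      filter_upwards [hw' W hWb] with τ hτ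
      exact norm_mul₃_le.trans (by gcongr))
    (fun t ht => by
      have := ((hWp t ht).star_mul_conj (extendedSemigroup S t)).mul_star_conj (S 0)
      rwa [hS.isSelfAdjoint.star_eq] at this)
  exact ⟨_, hX.isRiccatiMildSolution hS hQ0 hQ hWm hWb,
    fun t ht => (hXp t ht).mul_star_conj _⟩

theorem pulledBackCov_conj (hS : IsProjectedSemigroup S) {t : ℝ}
    (ht : 0 ≤ t) : extendedSemigroup S t * pulledBackCov S Pi t * star (extendedSemigroup S t) =
      Pi t := by
  have h1 := hS.extended_mul_inv ht
  have h2 : star (extendedSemigroupInv S t) * star (extendedSemigroup S t) = 1 := by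
    rw [← star_mul, h1, star_one]
  rw [pulledBackCov, ← mul_assoc, ← mul_assoc, h1, one_mul, mul_assoc, h2, mul_one]

theorem IsRiccatiMildSolution.eqOn (hS : IsProjectedSemigroup S)
    (hPi0 : S 0 * Pi0 * S 0 = Pi0) (hQ0 : ∀ τ, S 0 * Q τ * S 0 = Q τ)
    (hQ : IntegrableOn Q (Icc 0 T))
    (hWm : AEStronglyMeasurable W (volume.restrict (Icc 0 T)))
    (hWb : ∀ᵐ τ ∂(volume.restrict (Icc 0 T)), ‖W τ‖ ≤ w) {Pi' : ℝ → H →L[ℝ] H}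
    (hPi : IsRiccatiMildSolution T S Pi0 Q W Pi) (hPi' : IsRiccatiMildSolution T S Pi0 Q W Pi') :
    EqOn Pi Pi' (Icc 0 T) := by
  intro t ht
  obtain ⟨w', hw'⟩ := pulledBackCoeff_bound hS T w
  have := (hPi.solvesRiccati hS hPi0 hQ0 hQ hWm hWb).eqOn (pulledBackSource_integrableOn hS hQ)
    (pulledBackCoeff_aestronglyMeasurable hS hWm) (hw' W hWb)
    (hPi'.solvesRiccati hS hPi0 hQ0 hQ hWm hWb) ht
  rw [← pulledBackCov_conj hS ht.1 (Pi := Pi), this, pulledBackCov_conj hS ht.1]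

/-- Mild solutions of the Riccati equation depend continuously on the quadratic coefficient. -/
theorem IsRiccatiMildSolution.tendsto (hS : IsProjectedSemigroup S)
    (hPi0 : S 0 * Pi0 * S 0 = Pi0) (hPi0p : Pi0.IsPositive) (hQ0 : ∀ τ, S 0 * Q τ * S 0 = Q τ)
    (hQp : ∀ t ∈ Icc 0 T, (Q t).IsPositive) (hQ : IntegrableOn Q (Icc 0 T))
    {Wk Pik : ℕ → ℝ → H →L[ℝ] H}
    (hWm : AEStronglyMeasurable W (volume.restrict (Icc 0 T)))
    (hWb : ∀ᵐ τ ∂(volume.restrict (Icc 0 T)), ‖W τ‖ ≤ w)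
    (hWp : ∀ t ∈ Icc 0 T, (W t).IsPositive)
    (hWkm : ∀ k, AEStronglyMeasurable (Wk k) (volume.restrict (Icc 0 T)))
    (hWkb : ∀ k, ∀ᵐ τ ∂(volume.restrict (Icc 0 T)), ‖Wk k τ‖ ≤ w)
    (hWkp : ∀ k, ∀ t ∈ Icc 0 T, (Wk k t).IsPositive)
    (hlim : ∀ᵐ τ ∂(volume.restrict (Icc 0 T)), Tendsto (fun k => Wk k τ) atTop (𝓝 (W τ)))
    (hPi : IsRiccatiMildSolution T S Pi0 Q W Pi)
    (hPik : ∀ k, IsRiccatiMildSolution T S Pi0 Q (Wk k) (Pik k))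
    {t : ℝ} (ht : t ∈ Icc 0 T) : Tendsto (fun k => Pik k t) atTop (𝓝 (Pi t)) := by
  obtain ⟨w', hw'⟩ := pulledBackCoeff_bound hS T w
  have hT : 0 ≤ T := ht.1.trans ht.2
  have hQs := pulledBackSource_integrableOn hS hQ
  -- a bound common to all solutions, inherited from the constructed ones by uniqueness
  have hbound : ∀ {V R : ℝ → H →L[ℝ] H},
      AEStronglyMeasurable V (volume.restrict (Icc 0 T)) →
      (∀ᵐ τ ∂(volume.restrict (Icc 0 T)), ‖V τ‖ ≤ w) → (∀ t ∈ Icc 0 T, (V t).IsPositive) →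
      IsRiccatiMildSolution T S Pi0 Q V R → ∀ t ∈ Icc 0 T, ‖pulledBackCov S R t‖ ≤
        ‖Pi0‖ + ∫ τ in Icc 0 T, ‖pulledBackSource S Q τ‖ := by
    intro V R hVm hVb hVp hR s hs
    have hVm' := pulledBackCoeff_aestronglyMeasurable hS hVm
    obtain ⟨X, hX, -, hXb⟩ := exists_solvesRiccati hT hPi0p hQs
      (fun t ht => (hQp t ht).mul_star_conj _) hVm' (hw' V hVb)
      (fun t ht => (hVp t ht).star_mul_conj _)
    rw [(hR.solvesRiccati hS hPi0 hQ0 hQ hVm hVb).eqOn hQs hVm' (hw' V hVb) hX hs]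
    exact hXb s hs
  have key := SolvesRiccati.tendsto hQs (pulledBackCoeff_aestronglyMeasurable hS hWm) (hw' W hWb)
    (fun k => pulledBackCoeff_aestronglyMeasurable hS (hWkm k)) (fun k => hw' _ (hWkb k))
    (by
      filter_upwards [hlim] with τ hτ
      exact (hτ.const_mul _).mul_const _)
    (hPi.solvesRiccati hS hPi0 hQ0 hQ hWm hWb)
    (fun k => (hPik k).solvesRiccati hS hPi0 hQ0 hQ (hWkm k) (hWkb k))
    (hbound hWm hWb hWp hPi) (fun k => hbound (hWkm k) (hWkb k) (hWkp k) (hPik k)) ht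
  have := (key.const_mul (extendedSemigroup S t)).mul_const (star (extendedSemigroup S t))
  simpa only [pulledBackCov_conj hS ht.1] using this

end MildRiccati

/-! ### Schatten norms and traces -/

section Schatten

variable {H : Type*} [NormedAddCommGroup H] [InnerProductSpace ℝ H] [CompleteSpace H]

theorem enorm_le_schattenNorm {q : ℝ} (hq : 1 ≤ q) (B : H →L[ℝ] H) : ‖B‖ₑ ≤ schattenNorm q B := by
  refine le_sInf ?_
  rintro c ⟨w, b, s, hs, rfl⟩
  set c := (∑' i, (s i : ℝ≥0∞) ^ q) ^ (1 / q)
  have hq0 : 0 < q := by linarith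
  have hsc : ∀ i, (s i : ℝ≥0∞) ≤ c := fun i => by
    have h1 : (s i : ℝ≥0∞) = ((s i : ℝ≥0∞) ^ q) ^ (1 / q) := by
      rw [← ENNReal.rpow_mul, mul_one_div_cancel hq0.ne', ENNReal.rpow_one]
    rw [h1]
    exact ENNReal.rpow_le_rpow (ENNReal.le_tsum i) (by positivity)
  rcases eq_or_ne c ⊤ with hc | hc
  · rw [hc]; exact le_top
  lift c to ℝ≥0 using hc with r
  have hsr : ∀ i, (s i : ℝ) ≤ r := fun i => by exact_mod_cast hsc i
  have hs' : ∀ i, ContinuousLinearMap.adjoint B (B (b i)) = ((s i : ℝ) ^ 2) • b i := hs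
  have hadj : ∀ u v, inner ℝ u (ContinuousLinearMap.adjoint B (B v)) = inner ℝ (B u) (B v) :=
    fun u v => ContinuousLinearMap.adjoint_inner_right B u (B v)
  have hB : ‖B‖ ≤ r := by
    refine B.opNorm_le_bound r.coe_nonneg fun x => ?_
    have h1 := b.hasSum_inner_mul_inner x (ContinuousLinearMap.adjoint B (B x))
    have h2 := (b.hasSum_inner_mul_inner x x).mul_left ((r : ℝ) ^ 2)
    have h3 : ∀ i, inner ℝ x (b i) * inner ℝ (b i) (ContinuousLinearMap.adjoint B (B x)) ≤
        (r : ℝ) ^ 2 * (inner ℝ x (b i) * inner ℝ (b i) x) := fun i => by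
      have h5 : inner ℝ (b i) (ContinuousLinearMap.adjoint B (B x)) =
          (s i : ℝ) ^ 2 * inner ℝ x (b i) := by
        rw [hadj, real_inner_comm, ← hadj, hs' i, inner_smul_right]
      have h6 : inner ℝ (b i) x = inner ℝ x (b i) := real_inner_comm _ _
      have h7 : (s i : ℝ) ^ 2 ≤ (r : ℝ) ^ 2 := pow_le_pow_left₀ (s i).coe_nonneg (hsr i) 2
      rw [h5, h6]
      have := mul_le_mul_of_nonneg_right h7 (mul_self_nonneg (inner ℝ x (b i)))
      linarith
    have h4 := hasSum_le h3 h1 h2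
    rw [hadj, real_inner_self_eq_norm_sq, real_inner_self_eq_norm_sq, ← mul_pow] at h4
    exact le_of_sq_le_sq h4 (by positivity)
  rw [← ofReal_norm]
  exact (ENNReal.ofReal_le_ofReal hB).trans (by simp)

/-- Bochner integrability in a Schatten norm implies integrability in the operator norm. -/
theorem MemL1Schatten.integrableOn {q T : ℝ} (hq : 1 ≤ q) {F : ℝ → H →L[ℝ] H}
    (hF : MemL1Schatten q T F) : IntegrableOn F (Icc 0 T) := by
  obtain ⟨⟨s, -, hlim⟩, hfin⟩ := hF
  refine ⟨aestronglyMeasurable_of_tendsto_ae atTop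
    (fun k => (s k).stronglyMeasurable.aestronglyMeasurable) ?_, ?_⟩
  · filter_upwards [hlim] with t ht
    rw [tendsto_iff_edist_tendsto_0]
    refine tendsto_of_tendsto_of_tendsto_of_le_of_le tendsto_const_nhds ht (fun _ => zero_le)
      fun k => ?_
    rw [edist_comm, edist_eq_enorm_sub]
    exact enorm_le_schattenNorm hq _
  · exact lt_of_le_of_lt (lintegral_mono fun t => enorm_le_schattenNorm hq (F t)) hfin

/-- The trace of a positive operator on a finite-dimensional subspace `U`, extended by zero to the
orthogonal complement, is a finite sum over an orthonormal basis of `U`. -/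
theorem opTrace_eq_sum (U : Submodule ℝ H) [FiniteDimensional ℝ U] {G : H →L[ℝ] H}
    (hG : G.IsPositive) (hGU : G * U.starProjection = G) :
    opTrace G = ENNReal.ofReal (∑ j, inner ℝ (stdOrthonormalBasis ℝ U j : H)
      (G (stdOrthonormalBasis ℝ U j : H))) := by
  set e := stdOrthonormalBasis ℝ U
  unfold opTrace
  extract_lets b
  have hterm : ∀ i, inner ℝ (b i) (G (b i)) =
      ∑ j, inner ℝ (e j : H) (b i) * inner ℝ (b i) (G (e j : H)) := by
    intro i
    conv_lhs => rw [← hGU]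
    rw [mul_apply_eq_comp, e.starProjection_eq_sum_rankOne]
    simp [sum_apply, inner_sum, inner_smul_right]
  have hsum : HasSum (fun i => inner ℝ (b i) (G (b i)))
      (∑ j, inner ℝ (e j : H) (G (e j : H))) := by
    simp only [hterm]
    exact hasSum_sum fun j _ => b.hasSum_inner_mul_inner _ _
  rw [← hsum.tsum_eq, ENNReal.ofReal_tsum_of_nonneg (fun i => hG.inner_nonneg_right _)
    hsum.summable]

end Schatten

/-! ### Weak convergence in Hilbert spaces -/

section Weak

variable {E : Type*} [NormedAddCommGroup E] [InnerProductSpace ℝ E]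

/-- Sequential weak compactness of balls in a separable Hilbert space, from the Banach-Alaoglu
theorem and the identification of the space with its dual. -/
theorem exists_weakly_convergent_subseq [CompleteSpace E] [TopologicalSpace.SeparableSpace E]
    {x : ℕ → E} {M : ℝ} (hx : ∀ k, ‖x k‖ ≤ M) :
    ∃ (y : E) (φ : ℕ → ℕ), StrictMono φ ∧
      ∀ z, Tendsto (fun k => inner ℝ z (x (φ k))) atTop (𝓝 (inner ℝ z y)) := by
  obtain ⟨a, -, φ, hφ, ha⟩ := WeakDual.isSeqCompact_closedBall ℝ E 0 M
    (x := fun k => StrongDual.toWeakDual (InnerProductSpace.toDual ℝ E (x k)))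
    (fun k => by
      change InnerProductSpace.toDual ℝ E (x k) ∈ Metric.closedBall 0 M
      simpa using hx k)
  refine ⟨(InnerProductSpace.toDual ℝ E).symm (WeakDual.toStrongDual a), φ, hφ, fun z => ?_⟩
  have := ((WeakDual.eval_continuous z).tendsto a).comp ha
  refine (this.congr fun k => ?_).trans_eq ?_
  · exact real_inner_comm _ _
  · rw [real_inner_comm, InnerProductSpace.toDual_symm_apply]
    rfl

/-- Closed convex sets are weakly sequentially closed. -/
theorem mem_of_weak_limit {C : Set E} (hC : Convex ℝ C) (hCc : IsClosed C) [CompleteSpace E]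
    {x : ℕ → E} {y : E}
    (hxy : ∀ z, Tendsto (fun k => inner ℝ z (x k)) atTop (𝓝 (inner ℝ z y)))
    (hx : ∃ᶠ k in atTop, x k ∈ C) : y ∈ C := by
  by_contra hy
  obtain ⟨f, u, hf, hu⟩ := geometric_hahn_banach_closed_point hC hCc hy
  have hfz : ∀ v, f v = inner ℝ ((InnerProductSpace.toDual ℝ E).symm f) v := fun v => by
    rw [InnerProductSpace.toDual_symm_apply]
  have h1 := (hxy ((InnerProductSpace.toDual ℝ E).symm f)).eventually_const_lt
    (by rw [← hfz]; exact hu)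
  obtain ⟨k, hk, hk'⟩ := (hx.and_eventually h1).exists
  rw [← hfz] at hk'
  exact lt_asymm hk' (hf _ hk)

end Weak

/-! ### Sensor trajectories -/

section Trajectory

variable {E F : Type*} [NormedAddCommGroup E] [InnerProductSpace ℝ E]
  [NormedAddCommGroup F] [NormedSpace ℝ F] {T : ℝ}

theorem integrableOn_Lp_two {E : Type*} [NormedAddCommGroup E]
    (p : Lp E 2 (volume.restrict (Icc (0 : ℝ) T))) :
    IntegrableOn p (Icc 0 T) :=
  (Lp.memLp p).integrable one_le_two

/-- The components of the primitive of an `L²` function at a time `t` are continuous linear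
functionals of the function. -/
theorem inner_intervalIntegral_Lp_two [CompleteSpace E] {t : ℝ} (ht : t ∈ Icc 0 T) (c : E) :
    ∃ z : Lp E 2 (volume.restrict (Icc (0 : ℝ) T)), ‖z‖ ≤ ‖c‖ * T ^ (1 / 2 : ℝ) ∧
      ∀ p : Lp E 2 (volume.restrict (Icc (0 : ℝ) T)),
        inner ℝ c (∫ τ in (0 : ℝ)..t, p τ) = inner ℝ z p := by
  have hT : 0 ≤ T := ht.1.trans ht.2
  refine ⟨indicatorConstLp 2 (measurableSet_Ioc (a := (0 : ℝ)) (b := t)) (measure_ne_top _ _) c,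
    ?_, fun p => ?_⟩
  · refine norm_indicatorConstLp_le.trans ?_
    gcongr
    · simp only [ENNReal.toReal_ofNat]
      refine Real.rpow_le_rpow measureReal_nonneg ?_ (by norm_num)
      refine (measureReal_mono (subset_univ _)).trans ?_
      simp [hT]
  · rw [L2.inner_indicatorConstLp_eq_inner_setIntegral ℝ, intervalIntegral.integral_of_le ht.1,
      Measure.restrict_restrict measurableSet_Ioc,
      inter_eq_self_of_subset_left (Ioc_subset_Icc_self.trans (Icc_subset_Icc_right ht.2))]

theorem norm_intervalIntegral_sub_le [CompleteSpace E] {t : ℝ} (ht : t ∈ Icc 0 T)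
    (p p' : Lp E 2 (volume.restrict (Icc (0 : ℝ) T))) :
    ‖(∫ τ in (0 : ℝ)..t, p τ) - ∫ τ in (0 : ℝ)..t, p' τ‖ ≤ T ^ (1 / 2 : ℝ) * ‖p - p'‖ := by
  set b := (∫ τ in (0 : ℝ)..t, p τ) - ∫ τ in (0 : ℝ)..t, p' τ with hb
  obtain ⟨z, hz, hzp⟩ := inner_intervalIntegral_Lp_two ht b
  have h1 : ‖b‖ * ‖b‖ = inner ℝ z (p - p') := by
    rw [inner_sub_right, ← hzp, ← hzp, ← inner_sub_right, ← hb, real_inner_self_eq_norm_mul_norm]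
  have h2 := (real_inner_le_norm z (p - p')).trans
    (mul_le_mul_of_nonneg_right hz (norm_nonneg _))
  rcases eq_or_ne ‖b‖ 0 with h0 | h0
  · rw [h0]
    have : 0 ≤ T := ht.1.trans ht.2
    positivity
  · have hpos : 0 < ‖b‖ := lt_of_le_of_ne (norm_nonneg _) h0.symm
    refine le_of_mul_le_mul_left ?_ hpos
    rw [h1]
    linarith

theorem tendsto_intervalIntegral_of_weak [FiniteDimensional ℝ E]
    {p : Lp E 2 (volume.restrict (Icc (0 : ℝ) T))}
    {pk : ℕ → Lp E 2 (volume.restrict (Icc (0 : ℝ) T))}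
    (hw : ∀ z, Tendsto (fun k => inner ℝ z (pk k)) atTop (𝓝 (inner ℝ z p)))
    {t : ℝ} (ht : t ∈ Icc 0 T) :
    Tendsto (fun k => ∫ τ in (0 : ℝ)..t, pk k τ) atTop (𝓝 (∫ τ in (0 : ℝ)..t, p τ)) := by
  have hc : CompleteSpace E := FiniteDimensional.complete ℝ E
  set e := stdOrthonormalBasis ℝ E
  have h1 : ∀ b : E, ∑ j, inner ℝ (e j) b • e j = b := fun b => e.sum_repr' b
  have key : Tendsto (fun k => ∑ j, inner ℝ (e j) (∫ τ in (0 : ℝ)..t, pk k τ) • e j) atTop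
      (𝓝 (∑ j, inner ℝ (e j) (∫ τ in (0 : ℝ)..t, p τ) • e j)) := by
    refine tendsto_finsetSum _ fun j _ => Tendsto.smul_const ?_ _
    obtain ⟨z, -, hz⟩ := inner_intervalIntegral_Lp_two ht (e j)
    simp only [hz]
    exact hw z
  simpa only [h1] using key

/-- The integral equation of `ζ' = A ζ + B p`, `ζ(0) = ζ₀`. -/
def SolvesLinear (T : ℝ) (A : F →L[ℝ] F) (B : E →L[ℝ] F) (ζ₀ : F) (p : ℝ → E) (ζ : ℝ → F) : Prop :=
  ContinuousOn ζ (Icc 0 T) ∧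
    ∀ t ∈ Icc 0 T, ζ t = ζ₀ + ∫ τ in (0 : ℝ)..t, (A (ζ τ) + B (p τ))

variable {A : F →L[ℝ] F} {B : E →L[ℝ] F} {ζ₀ : F}

theorem linear_integrableOn {p : ℝ → E} (hp : IntegrableOn p (Icc 0 T)) {ζ : ℝ → F}
    (hζ : ContinuousOn ζ (Icc 0 T)) : IntegrableOn (fun τ => A (ζ τ) + B (p τ)) (Icc 0 T) :=
  ((A.continuous.comp_continuousOn hζ).integrableOn_Icc).add (B.integrable_comp hp)

theorem linear_lipschitz (p : ℝ → E) : ∀ᵐ τ ∂(volume.restrict (Icc 0 T)), ∀ x y : F,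
    ‖(A x + B (p τ)) - (A y + B (p τ))‖ ≤ ‖A‖ * ‖x - y‖ :=
  Eventually.of_forall fun τ x y => by
    rw [add_sub_add_right_eq_sub, ← map_sub]
    exact A.le_opNorm _

theorem exists_solvesLinear [CompleteSpace F] (hT : 0 ≤ T) {p : ℝ → E}
    (hp : IntegrableOn p (Icc 0 T)) : ∃ ζ, SolvesLinear T A B ζ₀ p ζ :=
  exists_volterra_solution (F := fun τ x => A x + B (p τ)) hT (norm_nonneg A)
    (fun _ hx => linear_integrableOn hp hx) (linear_lipschitz p) ζ₀

theorem SolvesLinear.eqOn {p : ℝ → E} (hp : IntegrableOn p (Icc 0 T)) {ζ ζ' : ℝ → F}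
    (h : SolvesLinear T A B ζ₀ p ζ) (h' : SolvesLinear T A B ζ₀ p ζ') : EqOn ζ ζ' (Icc 0 T) :=
  volterra_unique (F := fun τ x => A x + B (p τ)) (norm_nonneg A)
    (fun _ hx => linear_integrableOn hp hx) (linear_lipschitz p) h.1 h'.1 h.2 h'.2

/-- The trajectory depends on the control only through its primitive. -/
theorem SolvesLinear.norm_sub_le [CompleteSpace E] [CompleteSpace F] {p p' : ℝ → E}
    (hp : IntegrableOn p (Icc 0 T))
    (hp' : IntegrableOn p' (Icc 0 T)) {ζ ζ' : ℝ → F}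
    (h : SolvesLinear T A B ζ₀ p ζ) (h' : SolvesLinear T A B ζ₀ p' ζ') {t : ℝ} (ht : t ∈ Icc 0 T) :
    ‖ζ t - ζ' t‖ ≤ ‖B‖ * ‖(∫ τ in (0 : ℝ)..t, p τ) - ∫ τ in (0 : ℝ)..t, p' τ‖ +
      (‖A‖ * ‖B‖ * ∫ s in Icc 0 T, ‖(∫ τ in (0 : ℝ)..s, p τ) - ∫ τ in (0 : ℝ)..s, p' τ‖) *
        Real.exp (‖A‖ * t) := by
  have hT : 0 ≤ T := ht.1.trans ht.2
  have h0 : (0 : ℝ) ∈ Icc 0 T := ⟨le_rfl, hT⟩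
  set b : ℝ → E := fun s => (∫ τ in (0 : ℝ)..s, p τ) - ∫ τ in (0 : ℝ)..s, p' τ with hb
  have hbc : ContinuousOn b (Icc 0 T) := by
    have h1 := intervalIntegral.continuousOn_primitive_interval (μ := volume) (a := 0) (b := T)
      (f := p) (by rwa [uIcc_of_le hT])
    have h2 := intervalIntegral.continuousOn_primitive_interval (μ := volume) (a := 0) (b := T)
      (f := p') (by rwa [uIcc_of_le hT])
    rw [uIcc_of_le hT] at h1 h2
    exact h1.sub h2
  have hDc : ContinuousOn (fun s => ζ s - ζ' s) (Icc 0 T) := h.1.sub h'.1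
  have hzc : ContinuousOn (fun s => (ζ s - ζ' s) - B (b s)) (Icc 0 T) :=
    hDc.sub (B.continuous.comp_continuousOn hbc)
  -- after `B` times the primitive is subtracted, Gronwall's inequality applies
  have hz : ∀ s ∈ Icc 0 T, (ζ s - ζ' s) - B (b s) = ∫ τ in (0 : ℝ)..s, A (ζ τ - ζ' τ) := by
    intro s hs
    have i1 : IntervalIntegrable (fun τ => A (ζ τ)) volume 0 s :=
      intervalIntegrable_of_integrableOn_Icc
        ((A.continuous.comp_continuousOn h.1).integrableOn_Icc (μ := volume)) h0 hs
    have i2 : IntervalIntegrable (fun τ => A (ζ' τ)) volume 0 s :=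
      intervalIntegrable_of_integrableOn_Icc
        ((A.continuous.comp_continuousOn h'.1).integrableOn_Icc (μ := volume)) h0 hs
    have j1 := intervalIntegrable_of_integrableOn_Icc hp h0 hs
    have j2 := intervalIntegrable_of_integrableOn_Icc hp' h0 hs
    have e1 : ∫ τ in (0 : ℝ)..s, (A (ζ τ) + B (p τ)) =
        (∫ τ in (0 : ℝ)..s, A (ζ τ)) + B (∫ τ in (0 : ℝ)..s, p τ) := by
      rw [← B.intervalIntegral_comp_comm j1]
      exact intervalIntegral.integral_add i1
        (intervalIntegrable_of_integrableOn_Icc (B.integrable_comp hp) h0 hs)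
    have e2 : ∫ τ in (0 : ℝ)..s, (A (ζ' τ) + B (p' τ)) =
        (∫ τ in (0 : ℝ)..s, A (ζ' τ)) + B (∫ τ in (0 : ℝ)..s, p' τ) := by
      rw [← B.intervalIntegral_comp_comm j2]
      exact intervalIntegral.integral_add i2
        (intervalIntegrable_of_integrableOn_Icc (B.integrable_comp hp') h0 hs)
    have e3 : ∫ τ in (0 : ℝ)..s, A (ζ τ - ζ' τ) =
        (∫ τ in (0 : ℝ)..s, A (ζ τ)) - ∫ τ in (0 : ℝ)..s, A (ζ' τ) := by
      rw [← intervalIntegral.integral_sub i1 i2]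
      simp
    rw [h.2 s hs, h'.2 s hs, e1, e2, e3, hb]
    simp only [map_sub]
    abel
  have hbI : IntegrableOn (fun s => ‖b s‖) (Icc 0 T) := hbc.norm.integrableOn_Icc
  have key := norm_le_gronwall (L := ‖A‖) (δ := ‖A‖ * ‖B‖ * ∫ s in Icc 0 T, ‖b s‖)
    (norm_nonneg A) hzc (fun s hs => by
      have j1 : IntervalIntegrable (fun τ => ‖A‖ * ‖B‖ * ‖b τ‖) volume 0 s :=
        intervalIntegrable_of_integrableOn_Icc (hbI.const_mul _) h0 hs
      have j2 : IntervalIntegrable (fun τ => ‖A‖ * ‖(ζ τ - ζ' τ) - B (b τ)‖) volume 0 s :=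
        intervalIntegrable_of_integrableOn_Icc (T := T)
          ((hzc.norm.const_smul ‖A‖).integrableOn_Icc) h0 hs
      have hle : ∫ τ in (0 : ℝ)..s, ‖A‖ * ‖B‖ * ‖b τ‖ ≤ ‖A‖ * ‖B‖ * ∫ τ in Icc 0 T, ‖b τ‖ := by
        rw [intervalIntegral.integral_const_mul, intervalIntegral.integral_of_le hs.1]
        refine mul_le_mul_of_nonneg_left ?_ (by positivity)
        refine setIntegral_mono_set hbI (Eventually.of_forall fun _ => norm_nonneg _) ?_
        exact LE.le.eventuallyLE (Ioc_subset_Icc_self.trans (Icc_subset_Icc_right hs.2))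
      refine le_trans ?_ (add_le_add_left hle _)
      rw [← intervalIntegral.integral_add j1 j2, hz s hs]
      refine intervalIntegral.norm_integral_le_of_norm_le hs.1
        (Eventually.of_forall fun τ _ => ?_) (j1.add j2)
      refine (A.le_opNorm _).trans ?_
      rw [mul_assoc, ← mul_add]
      refine mul_le_mul_of_nonneg_left ?_ (norm_nonneg _)
      have h1 : ζ τ - ζ' τ = B (b τ) + ((ζ τ - ζ' τ) - B (b τ)) := by abel
      have h2 := norm_add_le (B (b τ)) ((ζ τ - ζ' τ) - B (b τ))
      rw [← h1] at h2
      exact h2.trans (add_le_add_left (B.le_opNorm _) _)) t ht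
  have h1 : ζ t - ζ' t = B (b t) + ((ζ t - ζ' t) - B (b t)) := by abel
  rw [h1]
  exact (norm_add_le _ _).trans (add_le_add (B.le_opNorm _) key)

/-- Weak convergence of bounded controls in `L²` implies bounded pointwise convergence of the
trajectories. -/
theorem SolvesLinear.tendsto_of_weak [FiniteDimensional ℝ E] [CompleteSpace F] (hT : 0 ≤ T)
    {p : Lp E 2 (volume.restrict (Icc (0 : ℝ) T))}
    {pk : ℕ → Lp E 2 (volume.restrict (Icc (0 : ℝ) T))}
    (hw : ∀ z, Tendsto (fun k => inner ℝ z (pk k)) atTop (𝓝 (inner ℝ z p)))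
    {K : ℝ} (hK : ∀ k, ‖pk k‖ ≤ K) {ζ : ℝ → F} {ζk : ℕ → ℝ → F}
    (h : SolvesLinear T A B ζ₀ p ζ) (hk : ∀ k, SolvesLinear T A B ζ₀ (pk k) (ζk k)) :
    (∀ t ∈ Icc 0 T, Tendsto (fun k => ζk k t) atTop (𝓝 (ζ t))) ∧
      ∃ R, ∀ k, ∀ t ∈ Icc 0 T, ‖ζk k t - ζ t‖ ≤ R := by
  have hc : CompleteSpace E := FiniteDimensional.complete ℝ E
  set b : ℕ → ℝ → E := fun k s => (∫ τ in (0 : ℝ)..s, pk k τ) - ∫ τ in (0 : ℝ)..s, p τ with hb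
  set r : ℝ := T ^ (1 / 2 : ℝ) * (K + ‖p‖) with hr
  have hbr : ∀ k, ∀ s ∈ Icc 0 T, ‖b k s‖ ≤ r := fun k s hs =>
    (norm_intervalIntegral_sub_le hs (pk k) p).trans
      (mul_le_mul_of_nonneg_left ((_root_.norm_sub_le _ _).trans (add_le_add_left (hK k) _))
        (by positivity))
  have hbm : ∀ k, AEStronglyMeasurable (fun s => ‖b k s‖) (volume.restrict (Icc 0 T)) := by
    intro k
    have h1 := intervalIntegral.continuousOn_primitive_interval (μ := volume) (a := 0) (b := T)
      (f := pk k) (by rw [uIcc_of_le hT]; exact integrableOn_Lp_two _)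
    have h2 := intervalIntegral.continuousOn_primitive_interval (μ := volume) (a := 0) (b := T)
      (f := p) (by rw [uIcc_of_le hT]; exact integrableOn_Lp_two _)
    rw [uIcc_of_le hT] at h1 h2
    exact (h1.sub h2).norm.aestronglyMeasurable measurableSet_Icc
  have hb0 : ∀ s ∈ Icc 0 T, Tendsto (fun k => ‖b k s‖) atTop (𝓝 0) := fun s hs => by
    have := (tendsto_intervalIntegral_of_weak hw hs).sub_const (∫ τ in (0 : ℝ)..s, p τ)
    rw [sub_self] at this
    simpa using this.norm
  have hI : Tendsto (fun k => ∫ s in Icc 0 T, ‖b k s‖) atTop (𝓝 0) := by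
    have := tendsto_integral_of_dominated_convergence (μ := volume.restrict (Icc 0 T))
      (F := fun k s => ‖b k s‖) (f := fun _ => (0 : ℝ)) (fun _ => r) hbm (integrable_const _)
      (fun k => by
        filter_upwards [ae_restrict_mem measurableSet_Icc] with s hs
        rw [norm_norm]
        exact hbr k s hs)
      (by
        filter_upwards [ae_restrict_mem measurableSet_Icc] with s hs
        exact hb0 s hs)
    simpa using this
  have hest : ∀ k, ∀ t ∈ Icc 0 T, ‖ζk k t - ζ t‖ ≤ ‖B‖ * ‖b k t‖ +
      (‖A‖ * ‖B‖ * ∫ s in Icc 0 T, ‖b k s‖) * Real.exp (‖A‖ * t) := fun k t ht =>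
    (hk k).norm_sub_le (integrableOn_Lp_two _) (integrableOn_Lp_two _) h ht
  refine ⟨fun t ht => ?_, ?_⟩
  · rw [tendsto_iff_norm_sub_tendsto_zero]
    refine squeeze_zero (fun _ => norm_nonneg _) (fun k => hest k t ht) ?_
    simpa using ((hb0 t ht).const_mul ‖B‖).add
      ((hI.const_mul (‖A‖ * ‖B‖)).mul_const (Real.exp (‖A‖ * t)))
  · obtain ⟨c, hc⟩ := hI.bddAbove_range
    have h0 : (0 : ℝ) ∈ Icc 0 T := ⟨le_rfl, hT⟩
    refine ⟨‖B‖ * r + (‖A‖ * ‖B‖ * c) * Real.exp (‖A‖ * T), fun k t ht => (hest k t ht).trans ?_⟩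
    have h1 : ∫ s in Icc 0 T, ‖b k s‖ ≤ c := hc ⟨k, rfl⟩
    have h2 : 0 ≤ c := le_trans (integral_nonneg fun _ => norm_nonneg _) h1
    have h3 := hbr k t ht
    have h4 := ht.2
    gcongr

end Trajectory

/-! ### The direct method -/

theorem liminf_add_liminf_le_liminf_add (u v : ℕ → ℝ≥0∞) :
    liminf u atTop + liminf v atTop ≤ liminf (fun k => u k + v k) atTop := by
  simp only [liminf_eq_iSup_iInf_of_nat]
  rw [ENNReal.iSup_add_iSup_of_monotone]
  · refine iSup_mono fun i => ?_
    exact le_iInf₂ fun k hk => add_le_add (iInf₂_le k hk) (iInf₂_le k hk)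
  · exact fun i j hij => le_iInf₂ fun k hk => iInf₂_le k (hij.trans hk)
  · exact fun i j hij => le_iInf₂ fun k hk => iInf₂_le k (hij.trans hk)

/-- A coercive and weakly sequentially lower semicontinuous functional, finite somewhere on a closed
convex subset of a separable Hilbert space, attains its minimum there. -/
theorem exists_minimizer {E : Type*} [NormedAddCommGroup E] [InnerProductSpace ℝ E]
    [CompleteSpace E] [TopologicalSpace.SeparableSpace E] {C : Set E} (hC : Convex ℝ C)
    (hCc : IsClosed C) {J : E → ℝ≥0∞} {d : ℝ} (hd : 0 < d)
    (hcoer : ∀ p ∈ C, ENNReal.ofReal (d * ‖p‖ ^ 2) ≤ J p)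
    (hlsc : ∀ (pk : ℕ → E) (p : E) (K : ℝ), (∀ k, pk k ∈ C) → p ∈ C → (∀ k, ‖pk k‖ ≤ K) →
      (∀ z, Tendsto (fun k => inner ℝ z (pk k)) atTop (𝓝 (inner ℝ z p))) →
      J p ≤ liminf (fun k => J (pk k)) atTop)
    (hfin : ∃ p ∈ C, J p < ⊤) : ∃ p ∈ C, J p < ⊤ ∧ ∀ p' ∈ C, J p ≤ J p' := by
  obtain ⟨p₀, hp₀, hJ₀⟩ := hfin
  have hne : (J '' C).Nonempty := ⟨J p₀, p₀, hp₀, rfl⟩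
  have hinf : sInf (J '' C) < ⊤ := lt_of_le_of_lt (sInf_le ⟨p₀, hp₀, rfl⟩) hJ₀
  obtain ⟨u, hua, hut, hu⟩ := exists_seq_tendsto_sInf hne (OrderBot.bddBelow _)
  obtain ⟨k₀, hk₀⟩ := (hut.eventually_lt_const hinf).exists
  choose x hxC hxu using hu
  set R := (u k₀).toReal
  have hbound : ∀ k, ‖x (k + k₀)‖ ≤ R / d + 1 := by
    intro k
    have h1 : ENNReal.ofReal (d * ‖x (k + k₀)‖ ^ 2) ≤ u k₀ :=
      (hcoer _ (hxC _)).trans ((hxu _).le.trans (hua (Nat.le_add_left _ _)))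
    have h2 : d * ‖x (k + k₀)‖ ^ 2 ≤ R := (ENNReal.ofReal_le_iff_le_toReal hk₀.ne).1 h1
    have h3 : ‖x (k + k₀)‖ ^ 2 ≤ R / d := by
      rw [le_div_iff₀ hd]
      linarith
    -- `r ≤ r² + 1`
    nlinarith [sq_nonneg (‖x (k + k₀)‖ - 1)]
  obtain ⟨p, φ, hφ, hw⟩ := exists_weakly_convergent_subseq hbound
  have hpC : p ∈ C := mem_of_weak_limit hC hCc hw (Eventually.of_forall fun k => hxC _).frequently
  have hJ := hlsc _ p _ (fun k => hxC (φ k + k₀)) hpC (fun k => hbound (φ k)) hw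
  have hlim : Tendsto (fun k => J (x (φ k + k₀))) atTop (𝓝 (sInf (J '' C))) := by
    simp only [hxu]
    exact hut.comp ((tendsto_add_atTop_nat k₀).comp hφ.tendsto_atTop)
  rw [hlim.liminf_eq] at hJ
  exact ⟨p, hpC, lt_of_le_of_lt hJ hinf, fun p' hp' => hJ.trans (sInf_le ⟨p', hp', rfl⟩)⟩

/-! ### The running cost of the guidance -/

section Running

variable {E : Type*} [NormedAddCommGroup E] {T : ℝ} {g : E → ℝ → ℝ}

/-- Continuous extension of the integrand to all times, by freezing it outside the time interval. -/
theorem continuous_uncurry_projIcc (hT : 0 ≤ T)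
    (hg : ContinuousOn (Function.uncurry g) (univ ×ˢ Icc 0 T)) :
    Continuous fun x : E × ℝ => g x.1 (projIcc 0 T hT x.2) :=
  hg.comp_continuous (f := fun x : E × ℝ => (x.1, (projIcc 0 T hT x.2 : ℝ)))
    (continuous_fst.prodMk (continuous_subtype_val.comp (continuous_projIcc.comp continuous_snd)))
    fun x => ⟨mem_univ _, (projIcc 0 T hT x.2).2⟩

theorem running_aemeasurable (hT : 0 ≤ T)
    (hg : ContinuousOn (Function.uncurry g) (univ ×ˢ Icc 0 T)) {p : ℝ → E}
    (hp : AEStronglyMeasurable p (volume.restrict (Icc 0 T))) :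
    AEMeasurable (fun t => ENNReal.ofReal (g (p t) t)) (volume.restrict (Icc 0 T)) := by
  have h1 := ((continuous_uncurry_projIcc hT hg).comp_aestronglyMeasurable
    (hp.prodMk aestronglyMeasurable_id)).aemeasurable.ennreal_ofReal
  refine h1.congr ?_
  filter_upwards [ae_restrict_mem measurableSet_Icc] with t ht
  simp [projIcc_of_mem hT ht]

theorem running_continuousOn (hg : ContinuousOn (Function.uncurry g) (univ ×ˢ Icc 0 T)) {p : ℝ → E}
    (hp : ContinuousOn p (Icc 0 T)) : ContinuousOn (fun t => g (p t) t) (Icc 0 T) :=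
  hg.comp (hp.prodMk continuousOn_id) fun _ ht => ⟨mem_univ _, ht⟩

theorem running_continuous_apply (hg : ContinuousOn (Function.uncurry g) (univ ×ˢ Icc 0 T)) {t : ℝ}
    (ht : t ∈ Icc 0 T) : Continuous fun u => g u t :=
  hg.comp_continuous (f := fun u : E => (u, t)) (by fun_prop) fun _ => ⟨mem_univ _, ht⟩

/-- The cost of the guidance is lower semicontinuous for strong convergence, by Fatou's lemma along
an almost everywhere convergent subsequence. -/
theorem isClosed_running_le (hT : 0 ≤ T)
    (hg : ContinuousOn (Function.uncurry g) (univ ×ˢ Icc 0 T)) (c : ℝ≥0∞) :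
    IsClosed {p : Lp E 2 (volume.restrict (Icc (0 : ℝ) T)) |
      ∫⁻ t in Icc 0 T, ENNReal.ofReal (g (p t) t) ≤ c} := by
  refine IsSeqClosed.isClosed fun pk p hpk hlim => ?_
  obtain ⟨φ, -, hφ⟩ := (tendstoInMeasure_of_tendsto_Lp hlim).exists_seq_tendsto_ae
  have h1 := lintegral_liminf_le' (μ := volume.restrict (Icc 0 T)) (u := atTop)
    (fun k => running_aemeasurable hT hg (Lp.aestronglyMeasurable (pk (φ k))))
  refine le_trans (le_trans (lintegral_mono_ae ?_) h1) ?_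
  · filter_upwards [hφ, ae_restrict_mem measurableSet_Icc] with t ht htm
    have := (((running_continuous_apply hg htm).tendsto _).comp ht)
    exact (ENNReal.tendsto_ofReal this).liminf_eq.ge
  · exact (liminf_le_liminf (Eventually.of_forall fun k => hpk (φ k))).trans (by simp)

theorem convex_running_le [NormedSpace ℝ E] (hT : 0 ≤ T)
    (hg : ContinuousOn (Function.uncurry g) (univ ×ˢ Icc 0 T))
    (hg0 : ∀ u, ∀ t ∈ Icc 0 T, 0 ≤ g u t)
    (hgc : ∀ t ∈ Icc 0 T, ConvexOn ℝ univ fun u => g u t) (c : ℝ≥0∞) :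
    Convex ℝ {p : Lp E 2 (volume.restrict (Icc (0 : ℝ) T)) |
      ∫⁻ t in Icc 0 T, ENNReal.ofReal (g (p t) t) ≤ c} := by
  intro p hp p' hp' a b ha hb hab
  have hm := (running_aemeasurable hT hg (Lp.aestronglyMeasurable p)).const_mul (ENNReal.ofReal a)
  calc ∫⁻ t in Icc 0 T, ENNReal.ofReal (g ((a • p + b • p' : Lp E 2 _) t) t)
      ≤ ∫⁻ t in Icc 0 T, (ENNReal.ofReal a * ENNReal.ofReal (g (p t) t) +
          ENNReal.ofReal b * ENNReal.ofReal (g (p' t) t)) := by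
        refine lintegral_mono_ae ?_
        filter_upwards [Lp.coeFn_add (a • p) (b • p'), Lp.coeFn_smul a p, Lp.coeFn_smul b p',
          ae_restrict_mem measurableSet_Icc] with t h1 h2 h3 ht
        rw [h1, Pi.add_apply, h2, h3, ← ENNReal.ofReal_mul ha, ← ENNReal.ofReal_mul hb,
          ← ENNReal.ofReal_add (mul_nonneg ha (hg0 _ t ht)) (mul_nonneg hb (hg0 _ t ht))]
        exact ENNReal.ofReal_le_ofReal ((hgc t ht).2 (mem_univ _) (mem_univ _) ha hb hab)
    _ = ENNReal.ofReal a * (∫⁻ t in Icc 0 T, ENNReal.ofReal (g (p t) t)) +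
          ENNReal.ofReal b * ∫⁻ t in Icc 0 T, ENNReal.ofReal (g (p' t) t) := by
        rw [lintegral_add_left' hm, lintegral_const_mul'' _
          (running_aemeasurable hT hg (Lp.aestronglyMeasurable p)), lintegral_const_mul'' _
          (running_aemeasurable hT hg (Lp.aestronglyMeasurable p'))]
    _ ≤ ENNReal.ofReal a * c + ENNReal.ofReal b * c := by gcongr <;> assumption
    _ = c := by
        rw [← add_mul, ← ENNReal.ofReal_add ha hb, hab, ENNReal.ofReal_one, one_mul]

/-- The cost of the guidance is weakly sequentially lower semicontinuous, since its sublevel sets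
are closed and convex. -/
theorem running_le_liminf_of_weak [InnerProductSpace ℝ E] [CompleteSpace E] (hT : 0 ≤ T)
    (hg : ContinuousOn (Function.uncurry g) (univ ×ˢ Icc 0 T))
    (hg0 : ∀ u, ∀ t ∈ Icc 0 T, 0 ≤ g u t)
    (hgc : ∀ t ∈ Icc 0 T, ConvexOn ℝ univ fun u => g u t)
    {p : Lp E 2 (volume.restrict (Icc (0 : ℝ) T))}
    {pk : ℕ → Lp E 2 (volume.restrict (Icc (0 : ℝ) T))}
    (hw : ∀ z, Tendsto (fun k => inner ℝ z (pk k)) atTop (𝓝 (inner ℝ z p))) :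
    ∫⁻ t in Icc 0 T, ENNReal.ofReal (g (p t) t) ≤
      liminf (fun k => ∫⁻ t in Icc 0 T, ENNReal.ofReal (g (pk k t) t)) atTop := by
  refine le_of_forall_gt_imp_ge_of_dense fun c hc => ?_
  exact mem_of_weak_limit (convex_running_le hT hg hg0 hgc c) (isClosed_running_le hT hg c) hw
    ((frequently_lt_of_liminf_lt (by isBoundedDefault) hc).mono fun k hk => hk.le)

end Running

section Admissible

variable {m : ℕ} {T : ℝ} {P : Set (EuclideanSpace ℝ (Fin m))}

theorem isClosed_admissibleGuidance (hP : IsClosed P) : IsClosed (admissibleGuidance T P) := by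
  refine IsSeqClosed.isClosed fun pk p hpk hlim => ?_
  obtain ⟨φ, -, hφ⟩ := (tendstoInMeasure_of_tendsto_Lp hlim).exists_seq_tendsto_ae
  have h1 : ∀ᵐ t ∂(volume.restrict (Icc (0 : ℝ) T)), ∀ k, pk k t ∈ P := ae_all_iff.2 hpk
  change ∀ᵐ t ∂_, p t ∈ P
  filter_upwards [hφ, h1] with t ht h
  exact hP.mem_of_tendsto ht (Eventually.of_forall fun k => h (φ k))

theorem convex_admissibleGuidance (hP : Convex ℝ P) : Convex ℝ (admissibleGuidance T P) := by
  intro p hp p' hp' a b ha hb hab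
  change ∀ᵐ t ∂_, (a • p + b • p' : Lp _ 2 _) t ∈ P
  filter_upwards [Lp.coeFn_add (a • p) (b • p'), Lp.coeFn_smul a p, Lp.coeFn_smul b p', hp, hp']
    with t h1 h2 h3 h4 h5
  rw [h1, Pi.add_apply, h2, h3]
  exact hP h4 h5 ha hb hab

/-- The cost of the guidance controls its `L²` norm. -/
theorem ofReal_norm_sq_le_running {g : EuclideanSpace ℝ (Fin m) → ℝ → ℝ} {d : ℝ} (hd : 0 < d)
    (hg : ∀ u ∈ P, ∀ t ∈ Icc 0 T, d * ‖u‖ ^ 2 ≤ g u t)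
    {p : Lp (EuclideanSpace ℝ (Fin m)) 2 (volume.restrict (Icc (0 : ℝ) T))}
    (hp : p ∈ admissibleGuidance T P) :
    ENNReal.ofReal (d * ‖p‖ ^ 2) ≤ ∫⁻ t in Icc 0 T, ENNReal.ofReal (g (p t) t) := by
  have h1 : d * ‖p‖ ^ 2 = ∫ t in Icc 0 T, d * inner ℝ (p t) (p t) := by
    rw [integral_const_mul, ← real_inner_self_eq_norm_sq, L2.inner_def]
  rw [h1, ofReal_integral_eq_lintegral_ofReal ((L2.integrable_inner p p).const_mul d)
    (Eventually.of_forall fun t => mul_nonneg hd.le real_inner_self_nonneg)]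
  refine lintegral_mono_ae ?_
  have hp' : ∀ᵐ t ∂(volume.restrict (Icc (0 : ℝ) T)), p t ∈ P := hp
  filter_upwards [hp', ae_restrict_mem measurableSet_Icc] with t h2 ht
  refine ENNReal.ofReal_le_ofReal ?_
  rw [real_inner_self_eq_norm_sq]
  exact hg _ h2 t ht

end Admissible

/-! ### Output operators along converging trajectories -/

section Output

variable {H : Type*} [NormedAddCommGroup H] [InnerProductSpace ℝ H] {ms n : ℕ} {T : ℝ}
  {σ : Fin ms → ℝ} {M : Matrix (Fin ms × Fin 2) (Fin n) ℝ} {C : Fin ms → Plane → ℝ → H}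

theorem continuous_rankOne_self : Continuous fun c : H => InnerProductSpace.rankOne ℝ c c :=
  (InnerProductSpace.rankOne ℝ).continuous.clm_apply continuous_id

theorem continuous_sensorLocation (M : Matrix (Fin ms × Fin 2) (Fin n) ℝ) (i : Fin ms) :
    Continuous fun z => sensorLocation M z i := by
  have h := (Matrix.toEuclideanLin M).continuous_of_finiteDimensional
  refine (PiLp.continuous_toLp 2 _).comp (continuous_pi fun k => ?_)
  exact (PiLp.continuous_apply 2 _ (i, k)).comp h

theorem sensorLocation_sub (M : Matrix (Fin ms × Fin 2) (Fin n) ℝ) (i : Fin ms)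
    (z z' : EuclideanSpace ℝ (Fin n)) :
    sensorLocation M (z - z') i = sensorLocation M z i - sensorLocation M z' i := by
  ext k
  simp [sensorLocation]

theorem sensorLocation_zero (M : Matrix (Fin ms × Fin 2) (Fin n) ℝ) (i : Fin ms) :
    sensorLocation M 0 i = 0 := by
  simpa using sensorLocation_sub M i 0 0

/-- A norm bound for the output operator, a sum of nonnegative operators of rank one, bounds each
output kernel. -/
theorem sq_norm_kernel_le (ζ : ℝ → EuclideanSpace ℝ (Fin n)) (t : ℝ) (i : Fin ms) :
    ((σ i) ^ 2)⁻¹ * ‖C i (sensorLocation M (ζ t) i) t‖ ^ 2 ≤ ‖outputOp σ M C ζ t‖ := by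
  set c : Fin ms → H := fun j => C j (sensorLocation M (ζ t) j) t with hc
  have h1 : inner ℝ (c i) (outputOp σ M C ζ t (c i)) =
      ∑ j, ((σ j) ^ 2)⁻¹ * inner ℝ (c j) (c i) ^ 2 := by
    simp only [outputOp, sum_apply, smul_apply, InnerProductSpace.rankOne_apply, inner_sum,
      inner_smul_right]
    refine Finset.sum_congr rfl fun j _ => ?_
    change ((σ j) ^ 2)⁻¹ * (inner ℝ (c j) (c i) * inner ℝ (c i) (c j)) = _
    rw [real_inner_comm (c j) (c i), ← sq]
  have h2 : ((σ i) ^ 2)⁻¹ * inner ℝ (c i) (c i) ^ 2 ≤ inner ℝ (c i) (outputOp σ M C ζ t (c i)) := by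
    rw [h1]
    exact Finset.single_le_sum (f := fun j => ((σ j) ^ 2)⁻¹ * inner ℝ (c j) (c i) ^ 2)
      (fun j _ => by positivity) (Finset.mem_univ i)
  have h3 : inner ℝ (c i) (outputOp σ M C ζ t (c i)) ≤ ‖outputOp σ M C ζ t‖ * ‖c i‖ ^ 2 :=
    (real_inner_le_norm _ _).trans (by
      nlinarith [(outputOp σ M C ζ t).le_opNorm (c i), norm_nonneg (c i)])
  rw [real_inner_self_eq_norm_sq] at h2
  change ((σ i) ^ 2)⁻¹ * ‖c i‖ ^ 2 ≤ _
  rcases eq_or_ne (‖c i‖ ^ 2) 0 with h0 | h0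
  · rw [h0, mul_zero]
    exact norm_nonneg _
  · have hpos : 0 < ‖c i‖ ^ 2 := lt_of_le_of_ne (by positivity) h0.symm
    refine le_of_mul_le_mul_right ?_ hpos
    linarith

theorem MeasureTheory.MemLp.exists_ae_norm_le {E : Type*} [NormedAddCommGroup E] {μ : Measure ℝ}
    {f : ℝ → E}
    (hf : MemLp f ⊤ μ) : ∃ w, ∀ᵐ t ∂μ, ‖f t‖ ≤ w := by
  refine ⟨(eLpNorm f ⊤ μ).toReal, ?_⟩
  have h := ae_le_eLpNormEssSup (f := f) (μ := μ)
  rw [← eLpNorm_exponent_top] at h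
  filter_upwards [h] with t ht
  rw [← toReal_enorm]
  exact ENNReal.toReal_mono hf.2.ne ht

/-- Bounded pointwise convergence of trajectories carries over to the output operators, by the
modulus of continuity of the output kernels. -/
theorem outputOp_tendsto_of_trajectories (hσ : ∀ i, 0 < σ i) {l : ℝ≥0 → ℝ≥0} (hl : Continuous l)
    (hl0 : l 0 = 0)
    (hC : ∀ t ∈ Icc 0 T, ∀ x₁ x₂ : Plane, ∀ i, ‖C i x₁ t - C i x₂ t‖₊ ≤ l ‖x₁ - x₂‖₊)
    {ζ : ℝ → EuclideanSpace ℝ (Fin n)} {ζk : ℕ → ℝ → EuclideanSpace ℝ (Fin n)}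
    (hlim : ∀ t ∈ Icc 0 T, Tendsto (fun k => ζk k t) atTop (𝓝 (ζ t)))
    {R : ℝ} (hR : ∀ k, ∀ t ∈ Icc 0 T, ‖ζk k t - ζ t‖ ≤ R)
    (hW : MemLp (outputOp σ M C ζ) ⊤ (volume.restrict (Icc 0 T))) :
    (∀ t ∈ Icc 0 T,
      Tendsto (fun k => outputOp σ M C (ζk k) t) atTop (𝓝 (outputOp σ M C ζ t))) ∧
    ∃ w, (∀ᵐ t ∂(volume.restrict (Icc 0 T)), ‖outputOp σ M C ζ t‖ ≤ w) ∧
      ∀ k, ∀ᵐ t ∂(volume.restrict (Icc 0 T)), ‖outputOp σ M C (ζk k) t‖ ≤ w := by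
  set ρ : Fin ms → EuclideanSpace ℝ (Fin n) → ℝ := fun i z => l ‖sensorLocation M z i‖₊ with hρ
  have hρc : ∀ i, Continuous (ρ i) := fun i =>
    NNReal.continuous_coe.comp (hl.comp (continuous_sensorLocation M i).nnnorm)
  have hρ0 : ∀ i, ρ i 0 = 0 := fun i => by simp [hρ, sensorLocation_zero, hl0]
  have hdiff : ∀ k, ∀ t ∈ Icc 0 T, ∀ i, ‖C i (sensorLocation M (ζk k t) i) t -
      C i (sensorLocation M (ζ t) i) t‖ ≤ ρ i (ζk k t - ζ t) := by
    intro k t ht i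
    have := hC t ht (sensorLocation M (ζk k t) i) (sensorLocation M (ζ t) i) i
    rw [← sensorLocation_sub] at this
    exact_mod_cast this
  constructor
  · intro t ht
    refine tendsto_finsetSum _ fun i _ => Tendsto.const_smul ?_ _
    have h1 : Tendsto (fun k => C i (sensorLocation M (ζk k t) i) t) atTop
        (𝓝 (C i (sensorLocation M (ζ t) i) t)) := by
      rw [tendsto_iff_norm_sub_tendsto_zero]
      refine squeeze_zero (fun _ => norm_nonneg _) (fun k => hdiff k t ht i) ?_
      have h2 : Tendsto (fun k => ζk k t - ζ t) atTop (𝓝 0) := by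
        simpa using (hlim t ht).sub_const (ζ t)
      have h3 := ((hρc i).tendsto 0).comp h2
      rw [hρ0] at h3
      exact h3
    exact (continuous_rankOne_self.tendsto _).comp h1
  · obtain ⟨w₀, hw₀⟩ := MemLp.exists_ae_norm_le hW
    have hb : ∀ i, ∃ b, ∀ z ∈ Metric.closedBall (0 : EuclideanSpace ℝ (Fin n)) R, ‖ρ i z‖ ≤ b :=
      fun i => (isCompact_closedBall 0 R).exists_bound_of_continuousOn (hρc i).continuousOn
    choose b hb using hb
    -- a bound on the kernels along `ζ`, from the bound on the output operator
    set c₀ : Fin ms → ℝ := fun i => (σ i) ^ 2 * w₀ + 1 with hc₀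
    have hker : ∀ᵐ t ∂(volume.restrict (Icc 0 T)), ∀ i,
        ‖C i (sensorLocation M (ζ t) i) t‖ ≤ c₀ i := by
      filter_upwards [hw₀] with t ht i
      have h1 := (sq_norm_kernel_le (σ := σ) (M := M) (C := C) ζ t i).trans ht
      have h2 : 0 < (σ i) ^ 2 := pow_pos (hσ i) 2
      rw [inv_mul_le_iff₀ h2] at h1
      nlinarith [sq_nonneg (‖C i (sensorLocation M (ζ t) i) t‖ - 1)]
    refine ⟨max w₀ (∑ i, ((σ i) ^ 2)⁻¹ * ((c₀ i + b i) * (c₀ i + b i))), ?_, fun k => ?_⟩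
    · filter_upwards [hw₀] with t ht
      exact ht.trans (le_max_left _ _)
    · filter_upwards [hker, ae_restrict_mem measurableSet_Icc] with t hk ht
      refine le_trans ?_ (le_max_right _ _)
      refine norm_sum_le_of_le _ fun i _ => ?_
      have h1 : ‖C i (sensorLocation M (ζk k t) i) t‖ ≤ c₀ i + b i := by
        have h2 := hdiff k t ht i
        have h3 := (le_abs_self _).trans (hb i (ζk k t - ζ t) (by simpa using hR k t ht))
        have h4 := norm_le_norm_add_norm_sub' (C i (sensorLocation M (ζk k t) i) t)
          (C i (sensorLocation M (ζ t) i) t)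
        have h5 := hk i
        linarith
      have h0 := (norm_nonneg _).trans h1
      rw [norm_smul, InnerProductSpace.norm_rankOne, Real.norm_of_nonneg (by positivity)]
      gcongr

end Output

/-! ### The approximate problem in an abstract Hilbert space -/

section Abstract

variable {H : Type*} [NormedAddCommGroup H] [InnerProductSpace ℝ H] {T : ℝ} {n m : ℕ}

theorem starProjection_mul_self (U : Submodule ℝ H) [FiniteDimensional ℝ U] :
    U.starProjection * U.starProjection = U.starProjection :=
  U.isIdempotentElem_starProjection

theorem outputOp_congr {ms : ℕ} {σ : Fin ms → ℝ} {M : Matrix (Fin ms × Fin 2) (Fin n) ℝ}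
    {C : Fin ms → Plane → ℝ → H} {ζ ζ' : ℝ → EuclideanSpace ℝ (Fin n)}
    (h : EqOn ζ ζ' (Icc 0 T)) : EqOn (outputOp σ M C ζ) (outputOp σ M C ζ') (Icc 0 T) := by
  intro t ht
  simp only [outputOp, h ht]

theorem starProjection_mul_compress_mul (U : Submodule ℝ H) [FiniteDimensional ℝ U]
    (B : H →L[ℝ] H) :
    U.starProjection * compress U B * U.starProjection = compress U B := by
  have h : compress U B = U.starProjection * B * U.starProjection := rfl
  rw [h, ← mul_assoc, ← mul_assoc, starProjection_mul_self, mul_assoc, starProjection_mul_self]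

theorem continuousOn_traceSum (U : Submodule ℝ H) [FiniteDimensional ℝ U] {Pi : ℝ → H →L[ℝ] H}
    (hPi : ContinuousOn Pi (Icc 0 T)) :
    ContinuousOn (fun t => ∑ j, inner ℝ (stdOrthonormalBasis ℝ U j : H)
      (Pi t (stdOrthonormalBasis ℝ U j : H))) (Icc 0 T) :=
  continuousOn_finsetSum _ fun _ _ =>
    continuousOn_const.inner (hPi.clm_apply continuousOn_const)

variable [CompleteSpace H]

theorem IsApproxSemigroup.isProjectedSemigroup {A : H → H → Prop} {S SN : ℝ → H →L[ℝ] H}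
    {U : Submodule ℝ H} [FiniteDimensional ℝ U] (h : IsApproxSemigroup A S U SN) :
    IsProjectedSemigroup SN where
  add := h.add
  continuousOn := h.continuousOn
  isSelfAdjoint := by
    rw [h.zero]
    exact isSelfAdjoint_starProjection U

theorem isSensorTrajectory_iff {α : Matrix (Fin n) (Fin n) ℝ} {β : Matrix (Fin n) (Fin m) ℝ}
    {ζ₀ : EuclideanSpace ℝ (Fin n)}
    {p : Lp (EuclideanSpace ℝ (Fin m)) 2 (volume.restrict (Icc (0 : ℝ) T))}
    {ζ : ℝ → EuclideanSpace ℝ (Fin n)} :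
    IsSensorTrajectory T α β ζ₀ p ζ ↔
      SolvesLinear T (Matrix.toEuclideanLin α).toContinuousLinearMap
        (Matrix.toEuclideanLin β).toContinuousLinearMap ζ₀ p ζ := Iff.rfl

theorem IsRiccatiMildSolution.congr {S Q W W' Pi : ℝ → H →L[ℝ] H} {Pi0 : H →L[ℝ] H}
    (hW : EqOn W W' (Icc 0 T)) (h : IsRiccatiMildSolution T S Pi0 Q W Pi) :
    IsRiccatiMildSolution T S Pi0 Q W' Pi := by
  refine ⟨h.1, fun t ht => ?_⟩
  rw [h.2 t ht]
  congr 1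
  refine intervalIntegral.integral_congr fun τ hτ => ?_
  rw [uIcc_of_le ht.1] at hτ
  rw [hW ⟨hτ.1, hτ.2.trans ht.2⟩]

/-- The trace and sensor state part of the running cost, as a function on the time interval. -/
def stateCost (h : EuclideanSpace ℝ (Fin n) → ℝ → ℝ) (ζ : ℝ → EuclideanSpace ℝ (Fin n))
    (Pi : ℝ → H →L[ℝ] H) (t : ℝ) : ℝ≥0∞ :=
  opTrace (Pi t) + ENNReal.ofReal (h (ζ t) t)

/-- The trace of a nonnegative operator on `U` is a finite sum, so the state part of the running
cost is the cast of an explicit real number. -/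
theorem stateCost_eq (U : Submodule ℝ H) [FiniteDimensional ℝ U]
    {h : EuclideanSpace ℝ (Fin n) → ℝ → ℝ}
    {ζ : ℝ → EuclideanSpace ℝ (Fin n)} {Pi : ℝ → H →L[ℝ] H} {t : ℝ} (hPi : (Pi t).IsPositive)
    (hU : Pi t * U.starProjection = Pi t) (hh : 0 ≤ h (ζ t) t) :
    stateCost h ζ Pi t = ENNReal.ofReal ((∑ j, inner ℝ (stdOrthonormalBasis ℝ U j : H)
      (Pi t (stdOrthonormalBasis ℝ U j : H))) + h (ζ t) t) := by
  rw [stateCost, opTrace_eq_sum U hPi hU, ENNReal.ofReal_add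
    (Finset.sum_nonneg fun j _ => hPi.inner_nonneg_right _) hh]

theorem guidanceCost_eq {h : EuclideanSpace ℝ (Fin n) → ℝ → ℝ}
    {g : EuclideanSpace ℝ (Fin m) → ℝ → ℝ} {hf : EuclideanSpace ℝ (Fin n) → ℝ}
    {p : Lp (EuclideanSpace ℝ (Fin m)) 2 (volume.restrict (Icc (0 : ℝ) T))}
    {ζ : ℝ → EuclideanSpace ℝ (Fin n)} {Pi : ℝ → H →L[ℝ] H}
    (hm : AEMeasurable (stateCost h ζ Pi) (volume.restrict (Icc 0 T))) :
    guidanceCost T h g hf p ζ Pi = (∫⁻ t in Icc 0 T, stateCost h ζ Pi t) +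
      (∫⁻ t in Icc 0 T, ENNReal.ofReal (g (p t) t)) + ENNReal.ofReal (hf (ζ T)) := by
  rw [guidanceCost, ← lintegral_add_left' hm]
  rfl

theorem guidanceCost_congr (hT : 0 ≤ T) {h : EuclideanSpace ℝ (Fin n) → ℝ → ℝ}
    {g : EuclideanSpace ℝ (Fin m) → ℝ → ℝ} {hf : EuclideanSpace ℝ (Fin n) → ℝ}
    {p : Lp (EuclideanSpace ℝ (Fin m)) 2 (volume.restrict (Icc (0 : ℝ) T))}
    {ζ ζ' : ℝ → EuclideanSpace ℝ (Fin n)} {Pi Pi' : ℝ → H →L[ℝ] H}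
    (hζ : EqOn ζ ζ' (Icc 0 T)) (hPi : EqOn Pi Pi' (Icc 0 T)) :
    guidanceCost T h g hf p ζ Pi = guidanceCost T h g hf p ζ' Pi' := by
  rw [guidanceCost, guidanceCost, hζ ⟨hT, le_rfl⟩]
  congr 1
  refine setLIntegral_congr_fun measurableSet_Icc fun t ht => ?_
  rw [hζ ht, hPi ht]

/-- Well-posedness of the approximate problem: existence, positivity and uniqueness of the sensor
state and of the covariance. -/
theorem approximateProblem_wellPosed (hT : 0 ≤ T) {ms : ℕ} {α : Matrix (Fin n) (Fin n) ℝ}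
    {β : Matrix (Fin n) (Fin m) ℝ} {ζ₀ : EuclideanSpace ℝ (Fin n)}
    {M : Matrix (Fin ms × Fin 2) (Fin n) ℝ} {σ : Fin ms → ℝ} {C : Fin ms → Plane → ℝ → H}
    {S Q : ℝ → H →L[ℝ] H} {Pi0 : H →L[ℝ] H} (hS : IsProjectedSemigroup S)
    (hPi0 : S 0 * Pi0 * S 0 = Pi0) (hPi0p : Pi0.IsPositive) (hQ0 : ∀ τ, S 0 * Q τ * S 0 = Q τ)
    (hQp : ∀ t ∈ Icc 0 T, (Q t).IsPositive) (hQ : IntegrableOn Q (Icc 0 T))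
    (hC : ∀ ζ : ℝ → EuclideanSpace ℝ (Fin n), ContinuousOn ζ (Icc 0 T) →
      MemLp (outputOp σ M C ζ) ⊤ (volume.restrict (Icc 0 T)))
    (hCp : ∀ ζ : ℝ → EuclideanSpace ℝ (Fin n), ContinuousOn ζ (Icc 0 T) →
      ∀ t ∈ Icc 0 T, (outputOp σ M C ζ t).IsPositive)
    (p : Lp (EuclideanSpace ℝ (Fin m)) 2 (volume.restrict (Icc (0 : ℝ) T))) :
    ∃ ζ Pi, IsSensorTrajectory T α β ζ₀ p ζ ∧
      IsRiccatiMildSolution T S Pi0 Q (outputOp σ M C ζ) Pi ∧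
      (∀ t ∈ Icc 0 T, (Pi t).IsPositive) ∧
      ∀ ζ' Pi', IsSensorTrajectory T α β ζ₀ p ζ' →
        IsRiccatiMildSolution T S Pi0 Q (outputOp σ M C ζ') Pi' →
        EqOn ζ' ζ (Icc 0 T) ∧ EqOn Pi' Pi (Icc 0 T) := by
  obtain ⟨ζ, hζ⟩ := exists_solvesLinear (A := (Matrix.toEuclideanLin α).toContinuousLinearMap)
    (B := (Matrix.toEuclideanLin β).toContinuousLinearMap) (ζ₀ := ζ₀) hT (integrableOn_Lp_two p)
  have hW := hC ζ hζ.1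
  obtain ⟨w, hw⟩ := MemLp.exists_ae_norm_le hW
  obtain ⟨Pi, hPi, hPip⟩ := exists_riccatiMildSolution hT hS hPi0p hQ0 hQp hQ hW.1 hw
    (hCp ζ hζ.1)
  refine ⟨ζ, Pi, hζ, hPi, hPip, fun ζ' Pi' hζ' hPi' => ?_⟩
  have h1 : EqOn ζ' ζ (Icc 0 T) :=
    SolvesLinear.eqOn (integrableOn_Lp_two p) (isSensorTrajectory_iff.1 hζ') hζ
  exact ⟨h1, IsRiccatiMildSolution.eqOn hS hPi0 hQ0 hQ hW.1 hw
    (hPi'.congr (outputOp_congr h1)) hPi⟩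

/-- The approximate problem has a solution. Along weakly convergent guidance the sensor states and
the covariances converge at every time, so that Fatou's lemma applies to their part of the cost. -/
theorem approximateProblem_exists_minimizer (hT : 0 ≤ T) {ms : ℕ}
    {α : Matrix (Fin n) (Fin n) ℝ} {β : Matrix (Fin n) (Fin m) ℝ}
    {ζ₀ : EuclideanSpace ℝ (Fin n)} {M : Matrix (Fin ms × Fin 2) (Fin n) ℝ} {σ : Fin ms → ℝ}
    (hσ : ∀ i, 0 < σ i) {C : Fin ms → Plane → ℝ → H} {S Q : ℝ → H →L[ℝ] H} {Pi0 : H →L[ℝ] H}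
    {U : Submodule ℝ H} [FiniteDimensional ℝ U] (hU : S 0 = U.starProjection)
    (hS : IsProjectedSemigroup S)
    (hPi0 : S 0 * Pi0 * S 0 = Pi0) (hPi0p : Pi0.IsPositive) (hQ0 : ∀ τ, S 0 * Q τ * S 0 = Q τ)
    (hQp : ∀ t ∈ Icc 0 T, (Q t).IsPositive) (hQ : IntegrableOn Q (Icc 0 T))
    (hC : ∀ ζ : ℝ → EuclideanSpace ℝ (Fin n), ContinuousOn ζ (Icc 0 T) →
      MemLp (outputOp σ M C ζ) ⊤ (volume.restrict (Icc 0 T)))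
    (hCp : ∀ ζ : ℝ → EuclideanSpace ℝ (Fin n), ContinuousOn ζ (Icc 0 T) →
      ∀ t ∈ Icc 0 T, (outputOp σ M C ζ t).IsPositive)
    {l : ℝ≥0 → ℝ≥0} (hl : Continuous l) (hl0 : l 0 = 0)
    (hCl : ∀ t ∈ Icc 0 T, ∀ x₁ x₂ : Plane, ∀ i, ‖C i x₁ t - C i x₂ t‖₊ ≤ l ‖x₁ - x₂‖₊)
    {P : Set (EuclideanSpace ℝ (Fin m))} (hPn : P.Nonempty) (hPc : IsClosed P) (hPx : Convex ℝ P)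
    {h : EuclideanSpace ℝ (Fin n) → ℝ → ℝ} {g : EuclideanSpace ℝ (Fin m) → ℝ → ℝ}
    {hf : EuclideanSpace ℝ (Fin n) → ℝ}
    (hh : ContinuousOn (Function.uncurry h) (univ ×ˢ Icc 0 T)) (hh0 : ∀ z, ∀ t ∈ Icc 0 T, 0 ≤ h z t)
    (hg : ContinuousOn (Function.uncurry g) (univ ×ˢ Icc 0 T)) (hg0 : ∀ u, ∀ t ∈ Icc 0 T, 0 ≤ g u t)
    (hhf : Continuous hf) (hgc : ∀ t ∈ Icc 0 T, ConvexOn ℝ univ fun u => g u t)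
    {d : ℝ} (hd : 0 < d) (hgd : ∀ u ∈ P, ∀ t ∈ Icc 0 T, d * ‖u‖ ^ 2 ≤ g u t) :
    ∃ p ∈ admissibleGuidance T P, ∃ ζ Pi, IsSensorTrajectory T α β ζ₀ p ζ ∧
      IsRiccatiMildSolution T S Pi0 Q (outputOp σ M C ζ) Pi ∧
      guidanceCost T h g hf p ζ Pi < ⊤ ∧
      ∀ p' ∈ admissibleGuidance T P, ∀ ζ' Pi', IsSensorTrajectory T α β ζ₀ p' ζ' →
        IsRiccatiMildSolution T S Pi0 Q (outputOp σ M C ζ') Pi' →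
        guidanceCost T h g hf p ζ Pi ≤ guidanceCost T h g hf p' ζ' Pi' := by
  choose Z R hZ hR hRp huniq using
    fun p : Lp (EuclideanSpace ℝ (Fin m)) 2 (volume.restrict (Icc (0 : ℝ) T)) =>
      approximateProblem_wellPosed (α := α) (β := β) (ζ₀ := ζ₀) hT hS hPi0 hPi0p hQ0 hQp hQ
        hC hCp p
  set A : Lp (EuclideanSpace ℝ (Fin m)) 2 (volume.restrict (Icc (0 : ℝ) T)) → ℝ≥0∞ :=
    fun p => ∫⁻ t in Icc 0 T, stateCost h (Z p) (R p) t with hA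
  set G : Lp (EuclideanSpace ℝ (Fin m)) 2 (volume.restrict (Icc (0 : ℝ) T)) → ℝ≥0∞ :=
    fun p => ∫⁻ t in Icc 0 T, ENNReal.ofReal (g (p t) t) with hG
  set B : Lp (EuclideanSpace ℝ (Fin m)) 2 (volume.restrict (Icc (0 : ℝ) T)) → ℝ≥0∞ :=
    fun p => ENNReal.ofReal (hf (Z p T)) with hB
  have hWb : ∀ p, ∃ w, ∀ᵐ t ∂(volume.restrict (Icc 0 T)), ‖outputOp σ M C (Z p) t‖ ≤ w :=
    fun p => MemLp.exists_ae_norm_le (hC _ (hZ p).1)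
  have hRU : ∀ p, ∀ t ∈ Icc 0 T, R p t * U.starProjection = R p t := fun p t ht => by
    obtain ⟨w, hw⟩ := hWb p
    rw [← hU]
    exact ((hR p).proj_mul hS hQ (hC _ (hZ p).1).1 hw ht).2
  -- on the interval, the state cost is a continuous real function
  set D : Lp (EuclideanSpace ℝ (Fin m)) 2 (volume.restrict (Icc (0 : ℝ) T)) → ℝ → ℝ :=
    fun p t => (∑ j, inner ℝ (stdOrthonormalBasis ℝ U j : H)
      (R p t (stdOrthonormalBasis ℝ U j : H))) + h (Z p t) t with hD
  have hstate : ∀ p, ∀ t ∈ Icc 0 T, stateCost h (Z p) (R p) t = ENNReal.ofReal (D p t) :=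
    fun p t ht => stateCost_eq U (hRp p t ht) (hRU p t ht) (hh0 _ t ht)
  have hDc : ∀ p, ContinuousOn (D p) (Icc 0 T) := fun p =>
    (continuousOn_traceSum U (hR p).1).add (running_continuousOn hh (hZ p).1)
  have hmeas : ∀ p, AEMeasurable (stateCost h (Z p) (R p)) (volume.restrict (Icc 0 T)) := by
    intro p
    refine ((hDc p).aemeasurable measurableSet_Icc).ennreal_ofReal.congr ?_
    filter_upwards [ae_restrict_mem measurableSet_Icc] with t ht
    exact (hstate p t ht).symm
  have hcost : ∀ p, guidanceCost T h g hf p (Z p) (R p) = A p + G p + B p := fun p =>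
    guidanceCost_eq (hmeas p)
  -- makes the separability of `L²` available
  have : Fact ((2 : ℝ≥0∞) ≠ ⊤) := ⟨ENNReal.ofNat_ne_top⟩
  obtain ⟨p, hp, hpfin, hpmin⟩ := exists_minimizer (C := admissibleGuidance T P)
    (J := fun p => A p + G p + B p) (convex_admissibleGuidance hPx)
    (isClosed_admissibleGuidance hPc) hd
    (fun p hp => (ofReal_norm_sq_le_running hd hgd hp).trans
      (le_add_right (le_add_left le_rfl)))
    (by
      intro pk p K hpk hp hK hw
      obtain ⟨hζlim, r, hr⟩ := SolvesLinear.tendsto_of_weak hT hw hK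
        (isSensorTrajectory_iff.1 (hZ p)) (fun k => isSensorTrajectory_iff.1 (hZ (pk k)))
      obtain ⟨hWlim, w, hw1, hw2⟩ := outputOp_tendsto_of_trajectories (σ := σ) (M := M) hσ hl hl0
        hCl hζlim hr (hC _ (hZ p).1)
      have hRlim : ∀ t ∈ Icc 0 T, Tendsto (fun k => R (pk k) t) atTop (𝓝 (R p t)) := fun t ht =>
        IsRiccatiMildSolution.tendsto hS hPi0 hPi0p hQ0 hQp hQ (hC _ (hZ p).1).1 hw1
          (hCp _ (hZ p).1)
          (fun k => (hC _ (hZ (pk k)).1).1) hw2 (fun k => hCp _ (hZ (pk k)).1)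
          (by
            filter_upwards [ae_restrict_mem measurableSet_Icc] with τ hτ
            exact hWlim τ hτ)
          (hR p) (fun k => hR (pk k)) ht
      have hDlim : ∀ t ∈ Icc 0 T, Tendsto (fun k => D (pk k) t) atTop (𝓝 (D p t)) := by
        intro t ht
        refine Tendsto.add (tendsto_finsetSum _ fun j _ => ?_)
          (((running_continuous_apply hh ht).tendsto _).comp (hζlim t ht))
        exact tendsto_const_nhds.inner
          (((ContinuousLinearMap.apply ℝ H (stdOrthonormalBasis ℝ U j : H)).continuous.tendsto
            _).comp (hRlim t ht))
      have hAlim : A p ≤ liminf (fun k => A (pk k)) atTop := by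
        refine le_trans (lintegral_mono_ae ?_)
          (lintegral_liminf_le' (u := atTop) fun k => hmeas (pk k))
        filter_upwards [ae_restrict_mem measurableSet_Icc] with t ht
        have := (ENNReal.tendsto_ofReal (hDlim t ht)).liminf_eq
        simp only [← hstate _ t ht] at this
        exact this.ge
      have hGlim : G p ≤ liminf (fun k => G (pk k)) atTop :=
        running_le_liminf_of_weak hT hg hg0 hgc hw
      have hBlim : B p ≤ liminf (fun k => B (pk k)) atTop :=
        (ENNReal.tendsto_ofReal ((hhf.tendsto _).comp (hζlim T ⟨hT, le_rfl⟩))).liminf_eq.ge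
      calc A p + G p + B p
          ≤ liminf (fun k => A (pk k)) atTop + liminf (fun k => G (pk k)) atTop +
            liminf (fun k => B (pk k)) atTop := add_le_add (add_le_add hAlim hGlim) hBlim
        _ ≤ liminf (fun k => A (pk k) + G (pk k)) atTop + liminf (fun k => B (pk k)) atTop :=
            add_le_add_left (liminf_add_liminf_le_liminf_add _ _) _
        _ ≤ _ := liminf_add_liminf_le_liminf_add _ _)
    (by
      -- constant guidance has finite cost
      obtain ⟨u, hu⟩ := hPn
      set p := Lp.const 2 (volume.restrict (Icc (0 : ℝ) T)) u
      have hpu : ∀ᵐ t ∂(volume.restrict (Icc (0 : ℝ) T)), p t = u := Lp.coeFn_const _ _ _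
      have hfinite : ∀ {f : ℝ → ℝ}, ContinuousOn f (Icc 0 T) →
          ∫⁻ t in Icc 0 T, ENNReal.ofReal (f t) < ⊤ := fun hf =>
        (hf.integrableOn_Icc (μ := volume)).lintegral_lt_top
      refine ⟨p, hpu.mono fun t ht => ?_, ENNReal.add_lt_top.2 ⟨ENNReal.add_lt_top.2 ⟨?_, ?_⟩,
        ENNReal.ofReal_lt_top⟩⟩
      · rw [ht]; exact hu
      · rw [hA]
        beta_reduce
        rw [setLIntegral_congr_fun measurableSet_Icc (hstate p)]
        exact hfinite (hDc p)
      · have : G p = ∫⁻ t in Icc 0 T, ENNReal.ofReal (g u t) := by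
          refine lintegral_congr_ae ?_
          filter_upwards [hpu] with t ht
          rw [ht]
        rw [this]
        exact hfinite (running_continuousOn hg continuousOn_const))
  refine ⟨p, hp, Z p, R p, hZ p, hR p, (hcost p).trans_lt hpfin, fun p' hp' ζ' Pi' hζ' hPi' => ?_⟩
  obtain ⟨h1, h2⟩ := huniq p' ζ' Pi' hζ' hPi'
  rw [guidanceCost_congr hT h1 h2, hcost p, hcost p']
  exact hpmin p' hp'

end Abstract

end

/-! ### The approximate problem for the diffusion-advection equation -/

theorem mainTheorem2
    -- domain, diffusion coefficient, flow, and the semigroup of the diffusion-advection operator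
    (Ω : Set Plane) (hΩ_open : IsOpen Ω) (hΩ_bdd : Bornology.IsBounded Ω)
    (a : ℝ) (ha : 0 < a) (v : Plane)
    (S : ℝ → StateSpace Ω →L[ℝ] StateSpace Ω)
    (hS : IsSemigroupGeneratedBy (DiffusionAdvection Ω a v) S)
    -- horizon and sensor dynamics
    (tf : ℝ) (htf : 0 < tf) (ms n m : ℕ)
    (α : Matrix (Fin n) (Fin n) ℝ) (β : Matrix (Fin n) (Fin m) ℝ)
    (ζ₀ : EuclideanSpace ℝ (Fin n)) (M : Matrix (Fin ms × Fin 2) (Fin n) ℝ)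
    -- measurement: noise standard deviations and output kernels
    (σ : Fin ms → ℝ) (hσ : ∀ i, 0 < σ i)
    (C : Fin ms → Plane → ℝ → StateSpace Ω)
    -- covariances of the initial state noise and of the state noise
    (Pi0 : StateSpace Ω →L[ℝ] StateSpace Ω) (Q : ℝ → StateSpace Ω →L[ℝ] StateSpace Ω)
    -- approximation: subspaces, semigroups, output kernels
    (HN : ℕ → Submodule ℝ (StateSpace Ω)) [∀ N, FiniteDimensional ℝ (HN N)]
    (SN : ℕ → ℝ → StateSpace Ω →L[ℝ] StateSpace Ω)
    (hSN : ∀ N, IsApproxSemigroup (DiffusionAdvection Ω a v) S (HN N) (SN N))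
    (CN : ℕ → Fin ms → Plane → ℝ → StateSpace Ω)
    (hCN : ∀ N i x, ∀ t ∈ Icc 0 tf, CN N i x t ∈ HN N)
    -- guidance values and cost functions
    (P : Set (EuclideanSpace ℝ (Fin m))) (hP_nonempty : P.Nonempty)
    (h : EuclideanSpace ℝ (Fin n) → ℝ → ℝ) (g : EuclideanSpace ℝ (Fin m) → ℝ → ℝ)
    (hf : EuclideanSpace ℝ (Fin n) → ℝ)
    (q : ℝ) (hq : 1 ≤ q)
    -- (A5)
    (hPi0_mem : schattenNorm q Pi0 < ⊤) (hPi0_nonneg : Pi0.IsPositive)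
    (hPi0N_mem : ∀ N, schattenNorm q (compress (HN N) Pi0) < ⊤)
    (hPi0N_nonneg : ∀ N, (compress (HN N) Pi0).IsPositive)
    (hPi0N_tendsto :
      Tendsto (fun N => schattenNorm q (Pi0 - compress (HN N) Pi0)) atTop (𝓝 0))
    -- (A6)
    (hQ_mem : MemL1Schatten q tf Q) (hQ_nonneg : ∀ t ∈ Icc 0 tf, (Q t).IsPositive)
    (hQN_mem : ∀ N, MemL1Schatten q tf fun t => compress (HN N) (Q t))
    (hQN_nonneg : ∀ N, ∀ t ∈ Icc 0 tf, (compress (HN N) (Q t)).IsPositive)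
    (hQN_tendsto : ∀ t ∈ Icc 0 tf, Tendsto
      (fun N => ∫⁻ τ in Icc 0 t, schattenNorm q (Q τ - compress (HN N) (Q τ))) atTop (𝓝 0))
    -- (A7), for every continuous sensor trajectory
    (hC_mem : ∀ ζ : ℝ → EuclideanSpace ℝ (Fin n), ContinuousOn ζ (Icc 0 tf) →
      MemLp (outputOp σ M C ζ) ⊤ (volume.restrict (Icc 0 tf)))
    (hC_nonneg : ∀ ζ : ℝ → EuclideanSpace ℝ (Fin n), ContinuousOn ζ (Icc 0 tf) →
      ∀ t ∈ Icc 0 tf, (outputOp σ M C ζ t).IsPositive)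
    (hCN_mem : ∀ ζ : ℝ → EuclideanSpace ℝ (Fin n), ContinuousOn ζ (Icc 0 tf) →
      ∀ N, MemLp (outputOp σ M (CN N) ζ) ⊤ (volume.restrict (Icc 0 tf)))
    (hCN_nonneg : ∀ ζ : ℝ → EuclideanSpace ℝ (Fin n), ContinuousOn ζ (Icc 0 tf) →
      ∀ N, ∀ t ∈ Icc 0 tf, (outputOp σ M (CN N) ζ t).IsPositive)
    (hCN_tendsto : ∀ ζ : ℝ → EuclideanSpace ℝ (Fin n), ContinuousOn ζ (Icc 0 tf) →
      Tendsto (fun N => eLpNorm (fun t => outputOp σ M C ζ t - outputOp σ M (CN N) ζ t) ⊤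
        (volume.restrict (Icc 0 tf))) atTop (𝓝 0))
    -- (A8)
    (hCN_cont : ∀ N, ∃ l : ℝ≥0 → ℝ≥0, Continuous l ∧ l 0 = 0 ∧
      ∀ t ∈ Icc 0 tf, ∀ x₁ x₂ : Plane, ∀ i,
        ‖CN N i x₁ t - CN N i x₂ t‖₊ ≤ l ‖x₁ - x₂‖₊)
    -- (A9)
    (hP_closed : IsClosed P) (hP_convex : Convex ℝ P)
    -- (A10)
    (hh_cont : ContinuousOn (Function.uncurry h) (univ ×ˢ Icc 0 tf))
    (hh_nonneg : ∀ z, ∀ t ∈ Icc 0 tf, 0 ≤ h z t)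
    (hg_cont : ContinuousOn (Function.uncurry g) (univ ×ˢ Icc 0 tf))
    (hg_nonneg : ∀ u, ∀ t ∈ Icc 0 tf, 0 ≤ g u t)
    (hf_cont : Continuous hf) (hf_nonneg : ∀ z, 0 ≤ hf z)
    (hg_convex : ∀ t ∈ Icc 0 tf, ConvexOn ℝ univ fun u => g u t)
    -- (A11)
    (hg_coercive : ∃ d₁ : ℝ, 0 < d₁ ∧ ∀ u ∈ P, ∀ t ∈ Icc 0 tf, d₁ * ‖u‖ ^ 2 ≤ g u t)
    -- the dimension of the approximate problem
    (N : ℕ) :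
    -- every admissible guidance determines the sensor state and the approximate covariance
    (∀ p ∈ admissibleGuidance tf P, ∃ ζ Pi,
      IsSensorTrajectory tf α β ζ₀ p ζ ∧
      IsRiccatiMildSolution tf (SN N) (compress (HN N) Pi0) (fun t => compress (HN N) (Q t))
        (outputOp σ M (CN N) ζ) Pi ∧
      (∀ t ∈ Icc 0 tf, (Pi t).IsPositive) ∧
      ∀ ζ' Pi', IsSensorTrajectory tf α β ζ₀ p ζ' →
        IsRiccatiMildSolution tf (SN N) (compress (HN N) Pi0) (fun t => compress (HN N) (Q t))
          (outputOp σ M (CN N) ζ') Pi' →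
        EqOn ζ' ζ (Icc 0 tf) ∧ EqOn Pi' Pi (Icc 0 tf)) ∧
    -- the approximate problem has a solution
    (∃ p ∈ admissibleGuidance tf P, ∃ ζ Pi,
      IsSensorTrajectory tf α β ζ₀ p ζ ∧
      IsRiccatiMildSolution tf (SN N) (compress (HN N) Pi0) (fun t => compress (HN N) (Q t))
        (outputOp σ M (CN N) ζ) Pi ∧
      guidanceCost tf h g hf p ζ Pi < ⊤ ∧
      ∀ p' ∈ admissibleGuidance tf P, ∀ ζ' Pi',
        IsSensorTrajectory tf α β ζ₀ p' ζ' →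
        IsRiccatiMildSolution tf (SN N) (compress (HN N) Pi0) (fun t => compress (HN N) (Q t))
          (outputOp σ M (CN N) ζ') Pi' →
        guidanceCost tf h g hf p ζ Pi ≤ guidanceCost tf h g hf p' ζ' Pi') := by
  have hS' := (hSN N).isProjectedSemigroup
  have hU := (hSN N).zero
  have hcomp : ∀ B, SN N 0 * compress (HN N) B * SN N 0 = compress (HN N) B := fun B => by
    rw [hU]; exact starProjection_mul_compress_mul _ _
  have hQ := (hQN_mem N).integrableOn hq
  have hCm := fun ζ hζ => hCN_mem ζ hζ N
  have hCp := fun ζ hζ => hCN_nonneg ζ hζ N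
  obtain ⟨l, hl, hl0, hCl⟩ := hCN_cont N
  obtain ⟨d, hd, hgd⟩ := hg_coercive
  exact ⟨fun p _ => approximateProblem_wellPosed htf.le hS' (hcomp _) (hPi0N_nonneg N)
      (fun _ => hcomp _) (hQN_nonneg N) hQ hCm hCp p,
    approximateProblem_exists_minimizer htf.le hσ hU hS' (hcomp _) (hPi0N_nonneg N)
      (fun _ => hcomp _) (hQN_nonneg N) hQ hCm hCp hl hl0 hCl hP_nonempty hP_closed hP_convex
      hh_cont hh_nonneg hg_cont hg_nonneg hf_cont hg_convex hd hgd⟩
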